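/- **Definitions.** Two polynomials $P,Q\in\mathbb{C}[x]$ form a *Pell pair* if one of them is an even function, the other one is an odd function, and $|P(x)|^2+(1-x^2)|Q(x)|^2=1$ for all $x\in[-1,1]$. A polynomial $P\in\mathbb{C}[x]$ is *Pellian* if there is a $Q\in\mathbb{C}[x]$ such that $P,Q$ form a Pell pair. A polynomial $P\in\mathbb{R}[x]$ is *semi-Pellian* if it is the (coefficientwise) real part of a Pellian polynomial. Let $\Pi$ be an orthogonal projector on a complex Hilbert space, let $|\psi\rangle$ be a unit vector, and put $a=\|\Pi|\psi\rangle\|$ and $\bar a=\sqrt{1-a^2}$. If $a\notin\{0,1\}$, let $|\Pi\rangle=a^{-1}\Pi|\psi\rangle$, $|\Pi^\perp\rangle=\bar a^{-1}(I-\Pi)|\psi\rangle$ and $|\psi^\perp\rangle=\bar a|\Pi\rangle-a|\Pi^\perp\rangle$. If $a=0$, let $|\Pi^\perp\rangle=|\psi\rangle$ and let $|\Pi\rangle=|\psi^\perp\rangle$ be any unit vector orthogonal to $|\psi\rangle$; if $a=1$, let $|\Pi\rangle=|\psi\rangle$ and let $|\Pi^\perp\rangle=|\psi^\perp\rangle$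 be any unit vector orthogonal to $|\psi\rangle$. On the two-dimensional span of these states let $Z_\psi=|\psi\rangle\langle\psi|-|\psi^\perp\rangle\langle\psi^\perp|$ and $Z_\Pi=|\Pi\rangle\langle\Pi|-|\Pi^\perp\rangle\langle\Pi^\perp|$. A quantum algorithm acts on a workspace of qubits, which starts in $|0\cdots0\rangle$ and on which it may apply arbitrary unitaries and computational-basis measurements without charge, and on a system register, which it accesses only through oracles. With oracles $e^{i\phi Z_\psi},e^{i\phi Z_\Pi}$ (any $\phi\in\mathbb{R}$), it may apply such a rotation to the system register, or measure the system register in the basis $|\psi\rangle,|\psi^\perp\rangle$ or $|\Pi\rangle,|\Pi^\perp\rangle$ by a Hadamard test on $Z_\psi$ or $Z_\Pi$; each of these counts as one query. With oracles $e^{i\phi Z_\psi}\oplus e^{-i\phi Z_\psi}$ and $e^{i\phi Z_\Pi}\oplus e^{-i\phi Z_\Pi}$, it may apply such an operator, controlled by a workspace qubit, as one query. **Theorem (Sampling from a polynomial).** There is an absolute constant $C$ such that the following holds. Let $P$ be Pellian or semi-Pellian. For each of the four input labels $\psi,\psi^\perp,\Pi,\Pi^\perp$ there is a quantum algorithm,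 depending only on $P$ and the label, that makes at most $C\deg P$ queries (with $\deg 0:=0$), to the oracles $e^{i\phi Z_\psi},e^{i\phi Z_\Pi}$ if $P$ is Pellian, and to the oracles $e^{i\phi Z_\psi}\oplus e^{-i\phi Z_\psi}$, $e^{i\phi Z_\Pi}\oplus e^{-i\phi Z_\Pi}$ if $P$ is semi-Pellian, and that has the following property for all $\Pi$ and $|\psi\rangle$ as above. Run on the state with the given label, it outputs a random bit $\mathbf b_P\in\{0,1\}$ with $$\Pr[\mathbf b_P=1]=|P(a)|^2,\qquad \Pr[\mathbf b_P=0]=1-|P(a)|^2,$$ and it leaves the system register in one of the four states $|\psi\rangle,|\psi^\perp\rangle,|\Pi\rangle,|\Pi^\perp\rangle$ (up to a global phase, random among them), together with the label of that state. -/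

import Mathlib

open Polynomial

noncomputable section

namespace PolySampling

/-! ### Pellian and semi-Pellian polynomials -/

/-- Two complex polynomials of fixed and opposite parity (as functions) with
`|P(x)|² + (1 - x²)|Q(x)|² = 1` on `[-1, 1]`. -/
def IsPellPair (P Q : ℂ[X]) : Prop :=
  ((Function.Even (fun z : ℂ => P.eval z) ∧ Function.Odd (fun z : ℂ => Q.eval z)) ∨
    (Function.Odd (fun z : ℂ => P.eval z) ∧ Function.Even (fun z : ℂ => Q.eval z))) ∧
  ∀ x ∈ Set.Icc (-1 : ℝ) 1,
    ‖P.eval (x : ℂ)‖ ^ 2 + (1 - x ^ 2) * ‖Q.eval (x : ℂ)‖ ^ 2 = 1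

/-- `P` is the first member of a Pell pair. -/
def IsPellian (P : ℂ[X]) : Prop := ∃ Q : ℂ[X], IsPellPair P Q

/-- `P` is the (coefficientwise) real part of a Pellian polynomial. -/
def IsSemiPellian (P : ℝ[X]) : Prop :=
  ∃ R : ℂ[X], IsPellian R ∧ ∀ n : ℕ, P.coeff n = (R.coeff n).re

/-! ### The Grover subspace and its two bases -/

/-- The two orthonormal bases `ψ, ψ^⊥` and `Π, Π^⊥` of the Grover subspace. -/
inductive Axis
  | psi
  | proj
  deriving DecidableEq

/-- A label of one of the four states: `(s, false)` is the first vector of the basis `s`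
(`ψ` or `Π`) and `(s, true)` is the second one (`ψ^⊥` or `Π^⊥`). -/
abbrev Label := Axis × Bool

section Hilbert

variable {H : Type*} [NormedAddCommGroup H] [InnerProductSpace ℂ H]

/-- The four states of the Grover subspace of a projector `Pr` and a state `ψ`, where
`a = ‖Pr ψ‖`. If `a = 0` then `ψ^⊥ = Π` is an arbitrary state orthogonal to `Π^⊥ = ψ`; if
`a = 1` then `ψ^⊥ = Π^⊥` is an arbitrary state orthogonal to `Π = ψ`. -/
structure GroverFrame (Pr : H →L[ℂ] H) (ψ : H) where
  /-- the state `ψ^⊥` -/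
  psiPerp : H
  /-- the state `Π` -/
  proj : H
  /-- the state `Π^⊥` -/
  projPerp : H
  generic : ‖Pr ψ‖ ≠ 0 → ‖Pr ψ‖ ≠ 1 →
    proj = ((‖Pr ψ‖⁻¹ : ℝ) : ℂ) • Pr ψ ∧
    projPerp = (((√(1 - ‖Pr ψ‖ ^ 2))⁻¹ : ℝ) : ℂ) • (ψ - Pr ψ) ∧
    psiPerp = ((√(1 - ‖Pr ψ‖ ^ 2) : ℝ) : ℂ) • proj - ((‖Pr ψ‖ : ℝ) : ℂ) • projPerp
  of_zero : ‖Pr ψ‖ = 0 →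
    projPerp = ψ ∧ ‖proj‖ = 1 ∧ inner ℂ ψ proj = 0 ∧ psiPerp = proj
  of_one : ‖Pr ψ‖ = 1 →
    proj = ψ ∧ ‖projPerp‖ = 1 ∧ inner ℂ ψ projPerp = 0 ∧ psiPerp = projPerp

/-- The state with a given label. -/
def GroverFrame.ket {Pr : H →L[ℂ] H} {ψ : H} (G : GroverFrame Pr ψ) : Label → H
  | (Axis.psi, false) => ψ
  | (Axis.psi, true) => G.psiPerp
  | (Axis.proj, false) => G.proj
  | (Axis.proj, true) => G.projPerp

/-- `Z_ψ = |ψ⟩⟨ψ| - |ψ^⊥⟩⟨ψ^⊥|` and `Z_Π = |Π⟩⟨Π| - |Π^⊥⟩⟨Π^⊥|`. -/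
def GroverFrame.Z {Pr : H →L[ℂ] H} {ψ : H} (G : GroverFrame Pr ψ) (s : Axis) : H →L[ℂ] H :=
  InnerProductSpace.rankOne ℂ (G.ket (s, false)) (G.ket (s, false)) -
    InnerProductSpace.rankOne ℂ (G.ket (s, true)) (G.ket (s, true))

/-- The two-dimensional Grover subspace. -/
def GroverFrame.subspace {Pr : H →L[ℂ] H} {ψ : H} (G : GroverFrame Pr ψ) : Submodule ℂ H :=
  Submodule.span ℂ {ψ, G.psiPerp}

/-- The unitaries `O s φ` on the whole space implement `e^{iφZ_ψ}` (for `s = psi`) and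
`e^{iφZ_Π}` (for `s = proj`) on the Grover subspace, for all phases `φ`. Nothing is asked
outside the Grover subspace: it does not matter whether `Z_Π` is read there as `2Π - 1`, or
as `0`, and likewise for `Z_ψ`. -/
def GroverFrame.IsOracle {Pr : H →L[ℂ] H} {ψ : H} (G : GroverFrame Pr ψ)
    (O : Axis → ℝ → (H ≃ₗᵢ[ℂ] H)) : Prop :=
  ∀ (s : Axis) (φ : ℝ), ∀ v ∈ G.subspace,
    O s φ v = NormedSpace.exp ((Complex.I * (φ : ℂ)) • G.Z s) v

end Hilbert

/-! ### Quantum algorithms with oracle queries -/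

/-- The kind of the oracles: `e^{iφZ}`, or `e^{iφZ} ⊕ e^{-iφZ}`. -/
inductive OracleKind
  | plain
  | signed

/-- Instructions of a quantum algorithm that acts on a workspace of `n` qubits and on a system
register which it accesses only through the oracles. -/
inductive Instr : OracleKind → ℕ → Type
  /-- a unitary on the workspace -/
  | work {κ : OracleKind} {n : ℕ} (W : Matrix.unitaryGroup (Fin n → Bool) ℂ) : Instr κ n
  /-- measure a workspace qubit in the computational basis -/
  | look {κ : OracleKind} {n : ℕ} (q : Fin n) : Instr κ n
  /-- query `e^{iφZ_s}` on the system register -/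
  | rotate {n : ℕ} (s : Axis) (φ : ℝ) : Instr OracleKind.plain n
  /-- measure the system register by a Hadamard test on `Z_s = -i e^{i(π/2)Z_s}` -/
  | hadamardTest {n : ℕ} (s : Axis) : Instr OracleKind.plain n
  /-- query `|0⟩⟨0| ⊗ e^{iφZ_s} + |1⟩⟨1| ⊗ e^{-iφZ_s}`, the first factor being the workspace
  qubit `q` and the second one the system register -/
  | rotateSigned {n : ℕ} (q : Fin n) (s : Axis) (φ : ℝ) : Instr OracleKind.signed n

/-- The number of oracle queries of an instruction; a Hadamard test counts as one query. -/
def Instr.queries {κ : OracleKind} {n : ℕ} : Instr κ n → ℕ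
  | .work _ => 0
  | .look _ => 0
  | .rotate _ _ => 1
  | .hadamardTest _ => 1
  | .rotateSigned _ _ _ => 1

/-- A quantum algorithm: the number of workspace qubits, the instructions in the order of
execution, and the outputs as functions of the record of measurement outcomes: a bit, and the
label of the state that is left in the system register. -/
structure Algorithm (κ : OracleKind) where
  qubits : ℕ
  code : List (Instr κ qubits)
  bit : List Bool → Bool
  label : List Bool → Label

/-- The total number of oracle queries. -/
def Algorithm.queries {κ : OracleKind} (A : Algorithm κ) : ℕ :=
  (A.code.map Instr.queries).sum

section Semantics

variable {H : Type*} [NormedAddCommGroup H] [InnerProductSpace ℂ H]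

/-- The effect of one instruction on a vector `∑ i, |i⟩ ⊗ v i` of workspace and system: the
list of its branches, each with its outcome (none unless it is a measurement) and its
unnormalized vector after the instruction. -/
def Instr.step (O : Axis → ℝ → (H ≃ₗᵢ[ℂ] H)) {κ : OracleKind} {n : ℕ} :
    Instr κ n → ((Fin n → Bool) → H) → List (List Bool × ((Fin n → Bool) → H))
  | .work W, v => [([], fun i => ∑ j, (W : Matrix (Fin n → Bool) (Fin n → Bool) ℂ) i j • v j)]
  | .look q, v =>
      [([false], fun i => if i q then 0 else v i), ([true], fun i => if i q then v i else 0)]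
  | .rotate s φ, v => [([], fun i => O s φ (v i))]
  | .hadamardTest s, v =>
      [([false], fun i => (2⁻¹ : ℂ) • (v i + (-Complex.I) • O s (Real.pi / 2) (v i))),
        ([true], fun i => (2⁻¹ : ℂ) • (v i - (-Complex.I) • O s (Real.pi / 2) (v i)))]
  | .rotateSigned q s φ, v => [([], fun i => O s (if i q then -φ else φ) (v i))]

/-- All branches of a sequence of instructions: the record of the measurement outcomes, and
the unnormalized final vector. -/
def runCode (O : Axis → ℝ → (H ≃ₗᵢ[ℂ] H)) {κ : OracleKind} {n : ℕ} :
    List (Instr κ n) → ((Fin n → Bool) → H) → List (List Bool × ((Fin n → Bool) → H))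
  | [], v => [([], v)]
  | c :: cs, v =>
      (c.step O v).flatMap fun p => (runCode O cs p.2).map fun p' => (p.1 ++ p'.1, p'.2)

/-- The branches of an algorithm run on the system state `v` and the workspace `|0…0⟩`. -/
def Algorithm.run {κ : OracleKind} (A : Algorithm κ) (O : Axis → ℝ → (H ≃ₗᵢ[ℂ] H)) (v : H) :
    List (List Bool × ((Fin A.qubits → Bool) → H)) :=
  runCode O A.code fun i => if i = fun _ => false then v else 0

/-- The probability that the output bit is `b`, by the Born rule. -/
def Algorithm.prob {κ : OracleKind} (A : Algorithm κ) (O : Axis → ℝ → (H ≃ₗᵢ[ℂ] H)) (v : H)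
    (b : Bool) : ℝ :=
  (((A.run O v).filter fun p => A.bit p.1 == b).map fun p => ∑ i, ‖p.2 i‖ ^ 2).sum

/-- On the system state `v` the output bit is `1` with probability `p` and `0` with probability
`1 - p`, and in every branch the system register is left, in a product state with the
workspace, in the one of the four states whose label is output. -/
def Algorithm.Samples {κ : OracleKind} (A : Algorithm κ) {Pr : H →L[ℂ] H} {ψ : H}
    (G : GroverFrame Pr ψ) (O : Axis → ℝ → (H ≃ₗᵢ[ℂ] H)) (v : H) (p : ℝ) : Prop :=
  A.prob O v true = p ∧ A.prob O v false = 1 - p ∧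
  ∀ r ∈ A.run O v, ∃ c : (Fin A.qubits → Bool) → ℂ, ∀ i, r.2 i = c i • G.ket (A.label r.1)

end Semantics

end PolySampling

end

open PolySampling

/-! A Pell pair `(P, Q)` of degree `d` gives the first row `(P(x), √(1-x²) Q(x))` of a unitary
`2 × 2` matrix. Quantum signal processing (`exists_phases`) writes this matrix as an alternating
product of `d + 1` diagonal phase rotations and `d` copies of the reflection
`[[x, √(1-x²)], [√(1-x²), -x]]`: the leading coefficients of `P` and `Q` have the same absolute
value, so that one phase rotation and one reflection can be split off in such a way that they
cancel and the degree drops. For `x = a = ‖Πψ‖` the reflection is the change of basis between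
`ψ, ψ^⊥` and `Π, Π^⊥` (up to the sign of `ψ^⊥` when `a = 1`), and the oracles are the phase
rotations in the two bases. Hence alternating queries followed by a measurement of the system
leave the index of the input state unchanged with probability `|P(a)|²`, and the state found is
one of the four. By unitarity the second row of the matrix has, up to a sign, the diagonal entry
`conj P(a)`, so that this holds for all input states.

For a semi-Pellian `P` the polynomial `R` with `P = Re R` may have a much larger degree than `P`.
A Fejér–Riesz theorem with parity (`isPellNorm_of_nonneg`), proved by removing roots and
Brahmagupta's identity, writes `1 - P² = A² + (1 - x²) B²`, and `(P + iA, B)` is a Pell pair of at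
most the degree of `P`. The signed oracles controlled by a qubit in the state `(|0⟩ + |1⟩)/√2` run
the rotations of this pair together with the opposite ones, which yield the conjugate amplitudes;
measuring the qubit after interference selects the real parts. The system is measured by one more
signed query. When `P` is constant no query is allowed: in the Pellian case `|P| = 1`, and in the
semi-Pellian case the output is a coin toss in the workspace. -/

namespace PolySampling

/-! ### The shape of a Pell pair -/

section Shape

variable {R : Type*} [CommRing R]

theorem coeff_comp_neg_X (P : R[X]) (n : ℕ) :
    (P.comp (-X)).coeff n = (-1) ^ n * P.coeff n := by
  have h : (-X : R[X]) = C (-1) * X := by simp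
  rw [h, comp_C_mul_X_coeff, mul_comm]

/-- The degree and parity constraints on a Pell pair of degree at most `d`: the parity of `P` is
that of `d`, and `Q` has the opposite parity. The bound `d - 1` on the degree of `Q` is put on
`X * Q`, so that it also says `Q = 0` for `d = 0`. -/
structure IsPellShape (d : ℕ) (P Q : R[X]) : Prop where
  natDegree_left : P.natDegree ≤ d
  natDegree_right : (X * Q).natDegree ≤ d
  parity_left : P.comp (-X) = (-1) ^ d * P
  parity_right : Q.comp (-X) = -((-1) ^ d * Q)

/-- The shape is preserved by the product `(P + i√(1-x²) Q)(P' + i√(1-x²) Q')`. -/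
theorem IsPellShape.mul {m n : ℕ} {P Q P' Q' : R[X]} (h : IsPellShape m P Q)
    (h' : IsPellShape n P' Q') :
    IsPellShape (m + n) (P * P' - (1 - X ^ 2) * (Q * Q')) (P * Q' + Q * P') := by
  obtain ⟨h1, h2, h3, h4⟩ := h
  obtain ⟨k1, k2, k3, k4⟩ := h'
  have aux : ∀ {d : ℕ} {S : R[X]}, (X * S).natDegree ≤ d → S.natDegree ≤ d := by
    intro d S hS
    nontriviality R
    by_cases h0 : S = 0
    · simp [h0]
    · rw [natDegree_X_mul h0] at hS
      lia
  refine ⟨?_, ?_, ?_, ?_⟩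
  · have e : P * P' - (1 - X ^ 2) * (Q * Q') = P * P' - Q * Q' + X * Q * (X * Q') := by ring
    rw [e]
    refine natDegree_add_le_of_degree_le ((natDegree_sub_le_of_le ?_ ?_).trans (max_self _).le) ?_
    · exact natDegree_mul_le_of_le h1 k1
    · exact natDegree_mul_le_of_le (aux h2) (aux k2)
    · exact natDegree_mul_le_of_le h2 k2
  · have e : X * (P * Q' + Q * P') = P * (X * Q') + X * Q * P' := by ring
    rw [e]
    exact natDegree_add_le_of_degree_le (natDegree_mul_le_of_le h1 k2)
      (natDegree_mul_le_of_le h2 k1)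
  · simp only [sub_comp, mul_comp, pow_comp, one_comp, X_comp, h3, h4, k3, k4]
    ring
  · simp only [add_comp, mul_comp, h3, h4, k3, k4]
    ring

theorem parity_eq_natDegree {R : Type*} [CommRing R] [IsDomain R] {P : R[X]} (hP : P ≠ 0)
    {ε : R} (h : P.comp (-X) = C ε * P) : ε = (-1) ^ P.natDegree := by
  have := congrArg (fun S => S.coeff P.natDegree) h
  simp only [coeff_comp_neg_X, coeff_C_mul] at this
  exact (mul_right_cancel₀ (leadingCoeff_ne_zero.2 hP) this).symm

end Shape

/-! ### Sums of squares with parity -/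

/-- `q(x²) = A(x)² + (1 - x²) B(x)²` for real polynomials `A`, `B` of the shape of a Pell pair of
degree at most `d`. -/
def IsPellNorm (d : ℕ) (q : ℝ[X]) : Prop :=
  ∃ A B : ℝ[X], IsPellShape d A B ∧ expand ℝ 2 q = A ^ 2 + (1 - X ^ 2) * B ^ 2

/-- Brahmagupta's identity. -/
theorem IsPellNorm.mul {m n : ℕ} {p q : ℝ[X]} (hp : IsPellNorm m p) (hq : IsPellNorm n q) :
    IsPellNorm (m + n) (p * q) := by
  obtain ⟨A, B, h, e⟩ := hp
  obtain ⟨A', B', h', e'⟩ := hq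
  refine ⟨_, _, h.mul h', ?_⟩
  rw [map_mul, e, e']
  ring

theorem isPellNorm_C {c : ℝ} (hc : 0 ≤ c) : IsPellNorm 0 (C c) := by
  refine ⟨C √c, 0, ⟨by simp, by simp, by simp, by simp⟩, ?_⟩
  simp [← C_pow, Real.sq_sqrt hc]

theorem isPellShape_one (a b : ℝ) : IsPellShape 1 (C a * X) (C b) := by
  refine ⟨(natDegree_C_mul_le a X).trans natDegree_X_le, ?_, by simp, by simp⟩
  rw [mul_comm]
  exact (natDegree_C_mul_le b X).trans natDegree_X_le

theorem isPellShape_two (a b c : ℝ) : IsPellShape 2 (C a * X ^ 2 + C b) (C c * X) := by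
  refine ⟨natDegree_add_le_of_degree_le (natDegree_C_mul_X_pow_le a 2) (by simp), ?_, by simp,
    by simp⟩
  have e : X * (C c * X) = C c * X ^ 2 := by ring
  rw [e]
  exact natDegree_C_mul_X_pow_le c 2

/-- An affine function is a combination `u y + v (1 - y)` of its end values on `[0, 1]`. -/
theorem isPellNorm_linear {u v : ℝ} (hu : 0 ≤ u) (hv : 0 ≤ v) :
    IsPellNorm 1 (C u * X + C v * (1 - X)) := by
  refine ⟨_, _, isPellShape_one √u √v, ?_⟩
  simp only [map_add, map_mul, expand_C, expand_X, map_sub, map_one, mul_pow, ← C_pow,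
    Real.sq_sqrt hu, Real.sq_sqrt hv]
  ring

theorem isPellNorm_sq (r : ℝ) : IsPellNorm 2 ((X - C r) ^ 2) := by
  refine ⟨_, _, isPellShape_two 1 (-r) 0, ?_⟩
  simp
  ring

/-- A quadratic without real roots. In terms of `y = x²` it is
`α y² + β y (1 - y) + γ (1 - y)²` with `α = 1 - 2 s + t`, `γ = t`, `β = 2 t - 2 s`; the square is
`(√α y - √γ (1 - y))²`, and what remains is a non-negative multiple of `y (1 - y)`. -/
theorem isPellNorm_quadratic {s t : ℝ} (h : s ^ 2 < t) :
    IsPellNorm 2 (X ^ 2 - C (2 * s) * X + C t) := by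
  have ht : 0 ≤ t := (sq_nonneg s).trans h.le
  have hα : 0 ≤ 1 - 2 * s + t := by nlinarith [sq_nonneg (1 - s)]
  have hm : s - t ≤ √(1 - 2 * s + t) * √t := by
    rw [← Real.sqrt_mul hα]
    apply Real.le_sqrt_of_sq_le
    nlinarith
  have hc : 0 ≤ 2 * t - 2 * s + 2 * (√(1 - 2 * s + t) * √t) := by linarith
  refine ⟨_, _, isPellShape_two (√(1 - 2 * s + t) + √t) (-√t)
    √(2 * t - 2 * s + 2 * (√(1 - 2 * s + t) * √t)), ?_⟩
  apply Polynomial.funext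
  intro x
  simp only [expand_eval, eval_add, eval_sub, eval_mul, eval_pow, eval_X, eval_C, eval_one,
    mul_pow, Real.sq_sqrt hc]
  have h1 := Real.sq_sqrt hα
  have h2 := Real.sq_sqrt ht
  linear_combination (-x ^ 4) * h1 + (-(x ^ 2 - 1) ^ 2) * h2

theorem nonneg_Icc_of_Ioo {f : ℝ → ℝ} (hf : Continuous f) {u v : ℝ} (huv : u < v)
    (h : ∀ y ∈ Set.Ioo u v, 0 ≤ f y) : ∀ y ∈ Set.Icc u v, 0 ≤ f y := by
  have hc : IsClosed {y | 0 ≤ f y} := isClosed_le continuous_const hf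
  have := closure_minimal (s := Set.Ioo u v) h hc
  rwa [closure_Ioo huv.ne] at this

/-- A version of the Fejér–Riesz theorem: a real polynomial that is non-negative on `[0, 1]` is a
Pell norm. The induction removes the roots; a root in `(0, 1)` is a double one. -/
theorem isPellNorm_of_nonneg (n : ℕ) : ∀ q : ℝ[X], q.natDegree ≤ n →
    (∀ y ∈ Set.Icc (0 : ℝ) 1, 0 ≤ q.eval y) → IsPellNorm n q := by
  induction n using Nat.strong_induction_on with
  | _ n ih =>
  intro q hq hpos
  rcases Nat.eq_zero_or_pos n with rfl | hn
  · rw [eq_C_of_natDegree_le_zero hq]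
    apply isPellNorm_C
    have := hpos 0 (by simp)
    rwa [← coeff_zero_eq_eval_zero] at this
  obtain ⟨m, rfl⟩ : ∃ m, n = m + 1 := ⟨n - 1, by lia⟩
  by_cases hlt : q.natDegree ≤ m
  · have := (ih m (by lia) q hlt hpos).mul (isPellNorm_linear zero_le_one zero_le_one)
    simpa using this
  have hd : q.natDegree = m + 1 := by lia
  obtain ⟨z, hz⟩ := Complex.exists_root (f := q.map (algebraMap ℝ ℂ)) (by
    rw [degree_map, degree_eq_natDegree (by rintro rfl; simp at hd), hd]
    exact_mod_cast Nat.succ_pos m)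
  have hz0 : aeval z q = 0 := by rwa [aeval_def, ← eval_map]
  by_cases him : z.im = 0
  · have hr : q.IsRoot z.re := by
      have e : z = algebraMap ℝ ℂ z.re := by apply Complex.ext <;> simp [him]
      rw [e, aeval_algebraMap_apply] at hz0
      exact (map_eq_zero _).1 hz0
    generalize z.re = r at hr
    obtain ⟨q₁, rfl⟩ := dvd_iff_isRoot.2 hr
    have hq₁ : q₁ ≠ 0 := by rintro rfl; simp at hd
    have hd₁ : q₁.natDegree = m := by
      rw [natDegree_mul (X_sub_C_ne_zero r) hq₁, natDegree_X_sub_C] at hd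
      lia
    have hpos' : ∀ y ∈ Set.Icc (0 : ℝ) 1, 0 ≤ (y - r) * q₁.eval y := by simpa using hpos
    rcases le_or_gt r 0 with hr0 | hr0
    · have h1 : ∀ y ∈ Set.Icc (0 : ℝ) 1, 0 ≤ q₁.eval y := by
        refine nonneg_Icc_of_Ioo q₁.continuous one_pos fun y hy => ?_
        exact nonneg_of_mul_nonneg_right (hpos' y ⟨hy.1.le, hy.2.le⟩) (by linarith [hy.1])
      have := (ih m (by lia) q₁ hd₁.le h1).mul
        (isPellNorm_linear (u := 1 - r) (v := -r) (by linarith) (by linarith))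
      convert this using 1
      simp only [map_sub, map_neg, map_one]
      ring
    rcases le_or_gt 1 r with hr1 | hr1
    · have h1 : ∀ y ∈ Set.Icc (0 : ℝ) 1, 0 ≤ (-q₁).eval y := by
        refine nonneg_Icc_of_Ioo (-q₁).continuous one_pos fun y hy => ?_
        have := hpos' y ⟨hy.1.le, hy.2.le⟩
        refine nonneg_of_mul_nonneg_right (?_ : 0 ≤ (r - y) * _) (by linarith [hy.2])
        rw [eval_neg]
        linarith
      have := (ih m (by lia) (-q₁) (by rw [natDegree_neg, hd₁]) h1).mul
        (isPellNorm_linear (u := r - 1) (v := r) (by linarith) (by linarith))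
      convert this using 1
      simp only [map_sub, map_one]
      ring
    have hright : ∀ y ∈ Set.Icc r 1, 0 ≤ q₁.eval y := by
      refine nonneg_Icc_of_Ioo q₁.continuous hr1 fun y hy => ?_
      exact nonneg_of_mul_nonneg_right (hpos' y ⟨(hr0.trans hy.1).le, hy.2.le⟩)
        (by linarith [hy.1])
    have hleft : ∀ y ∈ Set.Icc 0 r, 0 ≤ -q₁.eval y := by
      refine nonneg_Icc_of_Ioo q₁.continuous.neg hr0 fun y hy => ?_
      have := hpos' y ⟨hy.1.le, (hy.2.trans hr1).le⟩
      refine nonneg_of_mul_nonneg_right (?_ : 0 ≤ (r - y) * -q₁.eval y) (by linarith [hy.2])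
      linarith
    have hr₁ : q₁.IsRoot r :=
      le_antisymm (by linarith [hleft r ⟨hr0.le, le_rfl⟩]) (hright r ⟨le_rfl, hr1.le⟩)
    obtain ⟨q₂, rfl⟩ := dvd_iff_isRoot.2 hr₁
    have hq₂ : q₂ ≠ 0 := by rintro rfl; simp at hq₁
    have hd₂ : q₂.natDegree + 1 = m := by
      rw [natDegree_mul (X_sub_C_ne_zero r) hq₂, natDegree_X_sub_C] at hd₁
      lia
    have h2 : ∀ y ∈ Set.Icc (0 : ℝ) 1, 0 ≤ q₂.eval y := by
      have hr' : ∀ y ∈ Set.Icc r 1, 0 ≤ q₂.eval y := by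
        refine nonneg_Icc_of_Ioo q₂.continuous hr1 fun y hy => ?_
        have := hright y ⟨hy.1.le, hy.2.le⟩
        rw [eval_mul, eval_sub, eval_X, eval_C] at this
        exact nonneg_of_mul_nonneg_right this (by linarith [hy.1])
      have hl' : ∀ y ∈ Set.Icc 0 r, 0 ≤ q₂.eval y := by
        refine nonneg_Icc_of_Ioo q₂.continuous hr0 fun y hy => ?_
        have := hleft y ⟨hy.1.le, hy.2.le⟩
        rw [eval_mul, eval_sub, eval_X, eval_C] at this
        refine nonneg_of_mul_nonneg_right (?_ : 0 ≤ (r - y) * _) (by linarith [hy.2])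
        linarith
      intro y hy
      rcases le_total y r with h | h
      · exact hl' y ⟨hy.1, h⟩
      · exact hr' y ⟨h, hy.2⟩
    have := (ih q₂.natDegree (by lia) q₂ le_rfl h2).mul (isPellNorm_sq r)
    rw [show q₂.natDegree + 2 = m + 1 by lia] at this
    convert this using 1
    ring
  · obtain ⟨q₂, rfl⟩ := q.quadratic_dvd_of_aeval_eq_zero_im_ne_zero hz0 him
    have hlt : z.re ^ 2 < ‖z‖ ^ 2 := by
      rw [Complex.sq_norm, Complex.normSq_apply]
      have := sq_pos_of_ne_zero him
      nlinarith
    have hq₂ : q₂ ≠ 0 := by rintro rfl; simp at hd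
    have hdq : (X ^ 2 - C (2 * z.re) * X + C (‖z‖ ^ 2) : ℝ[X]).natDegree = 2 := by
      compute_degree!
    have hd₂ : q₂.natDegree + 1 = m := by
      rw [natDegree_mul (ne_zero_of_natDegree_gt (n := 1) (by rw [hdq]; norm_num)) hq₂, hdq] at hd
      lia
    have h2 : ∀ y ∈ Set.Icc (0 : ℝ) 1, 0 ≤ q₂.eval y := by
      intro y hy
      have := hpos y hy
      rw [eval_mul] at this
      refine nonneg_of_mul_nonneg_right this ?_
      simp only [eval_add, eval_sub, eval_mul, eval_pow, eval_X, eval_C]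
      nlinarith [sq_nonneg (y - z.re)]
    have := (ih q₂.natDegree (by lia) q₂ le_rfl h2).mul (isPellNorm_quadratic hlt)
    rw [show q₂.natDegree + 2 = m + 1 by lia] at this
    convert this using 1
    ring

/-! ### Pell pairs -/

theorem eval_map_conj (P : ℂ[X]) (x : ℝ) :
    (P.map (starRingEnd ℂ)).eval (x : ℂ) = starRingEnd ℂ (P.eval (x : ℂ)) := by
  conv_lhs => rw [← Complex.conj_ofReal x]
  exact eval_map_apply _ _

/-- Infinitely many points turn the Pell condition on `[-1, 1]` into an identity between
polynomials, from which the degrees can be read off. -/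
theorem pell_identity {P Q : ℂ[X]} (h : ∀ x ∈ Set.Icc (-1 : ℝ) 1,
    ‖P.eval (x : ℂ)‖ ^ 2 + (1 - x ^ 2) * ‖Q.eval (x : ℂ)‖ ^ 2 = 1) :
    P * P.map (starRingEnd ℂ) + (1 - X ^ 2) * (Q * Q.map (starRingEnd ℂ)) = 1 := by
  refine eq_of_infinite_eval_eq _ _ (((Set.Icc_infinite (by norm_num : (-1 : ℝ) < 1)).image
    Complex.ofReal_injective.injOn).mono ?_)
  rintro _ ⟨x, hx, rfl⟩
  have := congrArg Complex.ofReal (h x hx)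
  push_cast [← Complex.mul_conj'] at this
  simpa [eval_map_conj] using this

theorem comp_neg_X_eq_of_even {P : ℂ[X]} (h : Function.Even fun z : ℂ => P.eval z) :
    P.comp (-X) = P :=
  Polynomial.funext fun z => by simpa using h z

theorem comp_neg_X_eq_of_odd {P : ℂ[X]} (h : Function.Odd fun z : ℂ => P.eval z) :
    P.comp (-X) = -P :=
  Polynomial.funext fun z => by simpa using h z

theorem IsPellPair.exists_sign {P Q : ℂ[X]} (h : IsPellPair P Q) :
    ∃ ε : ℝ, P.comp (-X) = C (ε : ℂ) * P ∧ Q.comp (-X) = -(C (ε : ℂ) * Q) := by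
  rcases h.1 with ⟨h1, h2⟩ | ⟨h1, h2⟩
  · exact ⟨1, by simp [comp_neg_X_eq_of_even h1], by simp [comp_neg_X_eq_of_odd h2]⟩
  · exact ⟨-1, by simp [comp_neg_X_eq_of_odd h1], by simp [comp_neg_X_eq_of_even h2]⟩

theorem IsPellPair.isPellShape {P Q : ℂ[X]} (h : IsPellPair P Q) :
    IsPellShape P.natDegree P Q := by
  have hP : P ≠ 0 := by
    rintro rfl
    simpa using h.2 1 (by simp)
  obtain ⟨ε, h1, h2⟩ := h.exists_sign
  have hε := parity_eq_natDegree hP h1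
  rw [hε] at h1 h2
  refine ⟨le_rfl, ?_, by simpa using h1, by simpa using h2⟩
  by_cases hQ : Q = 0
  · simp [hQ]
  have hQ' : Q.map (starRingEnd ℂ) ≠ 0 :=
    (Polynomial.map_ne_zero_iff (starRingEnd ℂ).injective).2 hQ
  have hX : (1 - X ^ 2 : ℂ[X]).natDegree = 2 := by compute_degree!
  have hX' : (1 - X ^ 2 : ℂ[X]) ≠ 0 := ne_zero_of_natDegree_gt (n := 1) (by rw [hX]; norm_num)
  have e := congrArg natDegree (eq_sub_of_add_eq' (pell_identity h.2))
  rw [natDegree_mul hX' (mul_ne_zero hQ hQ'), natDegree_mul hQ hQ', hX, natDegree_map] at e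
  have h3 : (1 - P * P.map (starRingEnd ℂ)).natDegree ≤ P.natDegree + P.natDegree := by
    refine (natDegree_sub_le_of_le (m := 0) (by simp)
      (natDegree_mul_le_of_le le_rfl natDegree_map_le)).trans (by simp)
  rw [natDegree_X_mul hQ]
  lia

/-- The real part `P` of a Pellian polynomial is bounded by `1` on `[-1, 1]` and even or odd, hence
it is the real part `P = Re (P + iA)` of a Pellian polynomial of at most the same degree: here
`1 - P² = A² + (1 - x²) B²` by `isPellNorm_of_nonneg`. This step is needed because the polynomial
in the definition may have a much larger degree than `P`. -/
theorem IsSemiPellian.exists_pell {P : ℝ[X]} (h : IsSemiPellian P) :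
    ∃ R Q : ℂ[X], IsPellShape P.natDegree R Q ∧
      (∀ x ∈ Set.Icc (-1 : ℝ) 1,
        ‖R.eval (x : ℂ)‖ ^ 2 + (1 - x ^ 2) * ‖Q.eval (x : ℂ)‖ ^ 2 = 1) ∧
      ∀ x : ℝ, (R.eval (x : ℂ)).re = P.eval x := by
  obtain ⟨S, ⟨T, hST⟩, hP⟩ := h
  have hre : ∀ x : ℝ, (S.eval (x : ℂ)).re = P.eval x := by
    intro x
    have hdeg : P.natDegree ≤ S.natDegree :=
      natDegree_le_iff_coeff_eq_zero.2 fun n hn => by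
        rw [hP, coeff_eq_zero_of_natDegree_lt hn, Complex.zero_re]
    rw [eval_eq_sum_range, eval_eq_sum_range' (Nat.lt_succ_of_le hdeg), Complex.re_sum]
    refine Finset.sum_congr rfl fun n _ => ?_
    rw [hP, ← Complex.ofReal_pow, Complex.re_mul_ofReal]
  have hbound : ∀ x ∈ Set.Icc (-1 : ℝ) 1, P.eval x ^ 2 ≤ 1 := by
    intro x hx
    have h1 := hST.2 x hx
    have h2 : P.eval x ^ 2 ≤ ‖S.eval (x : ℂ)‖ ^ 2 := by
      rw [← hre, ← sq_abs]
      gcongr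
      exact Complex.abs_re_le_norm _
    have h3 : 0 ≤ (1 - x ^ 2) * ‖T.eval (x : ℂ)‖ ^ 2 :=
      mul_nonneg (by nlinarith [hx.1, hx.2]) (sq_nonneg _)
    linarith
  have hpar : P.comp (-X) = (-1) ^ P.natDegree * P := by
    by_cases h0 : P = 0
    · simp [h0]
    obtain ⟨ε, h1, -⟩ := hST.exists_sign
    have h2 : P.comp (-X) = C ε * P := by
      ext n
      have h3 := congrArg (fun U => (U.coeff n).re) h1
      have h4 : ((-1 : ℂ) ^ n * S.coeff n).re = (-1) ^ n * (S.coeff n).re := by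
        rcases neg_one_pow_eq_or ℂ n with h | h <;>
          rcases Nat.even_or_odd n with h' | h' <;> simp [h'.neg_one_pow]
      simpa [coeff_comp_neg_X, hP, h4] using h3
    rw [h2, parity_eq_natDegree h0 h2]
    simp
  -- The even polynomial `1 - P²` is `q(x²)`.
  set q := contract 2 (1 - P ^ 2) with hq
  have hexp : expand ℝ 2 q = 1 - P ^ 2 := by
    ext n
    rw [coeff_expand two_pos]
    split_ifs with hn
    · rw [hq, coeff_contract two_ne_zero, Nat.div_mul_cancel hn]
    · have h1 : (1 - P ^ 2).comp (-X) = 1 - P ^ 2 := by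
        rw [sub_comp, one_comp, pow_comp, hpar, mul_pow, ← pow_mul, mul_comm _ 2, pow_mul]
        simp
      have h2 := congrArg (fun U => U.coeff n) h1
      simp only [coeff_comp_neg_X, (Nat.not_even_iff_odd.1 (mt Even.two_dvd hn)).neg_one_pow] at h2
      linarith
  have hqdeg : q.natDegree ≤ P.natDegree := by
    have h1 := congrArg natDegree hexp
    rw [natDegree_expand] at h1
    have h2 : (1 - P ^ 2).natDegree ≤ 2 * P.natDegree :=
      (natDegree_sub_le_of_le (m := 0) (by simp) natDegree_pow_le).trans (by simp)
    lia
  obtain ⟨A, B, hAB, e⟩ := isPellNorm_of_nonneg P.natDegree q hqdeg fun y hy => by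
    have hs : √y ∈ Set.Icc (-1 : ℝ) 1 :=
      ⟨by linarith [Real.sqrt_nonneg y], Real.sqrt_le_one.2 hy.2⟩
    have h1 := congrArg (eval √y) hexp
    rw [expand_eval, Real.sq_sqrt hy.1] at h1
    rw [h1]
    simpa using hbound _ hs
  rw [hexp] at e
  have hR : ∀ x : ℝ, (P.map Complex.ofRealHom + C Complex.I * A.map Complex.ofRealHom).eval
      (x : ℂ) = (P.eval x : ℝ) + (A.eval x : ℝ) * Complex.I := by
    intro x
    have h1 : ∀ U : ℝ[X], (U.map Complex.ofRealHom).eval (x : ℂ) = (U.eval x : ℝ) :=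
      fun U => eval_map_apply Complex.ofRealHom x
    rw [eval_add, eval_mul, eval_C, h1, h1, mul_comm]
  refine ⟨P.map Complex.ofRealHom + C Complex.I * A.map Complex.ofRealHom,
    B.map Complex.ofRealHom, ⟨?_, ?_, ?_, ?_⟩, ?_, ?_⟩
  · refine natDegree_add_le_of_degree_le natDegree_map_le ((natDegree_C_mul_le _ _).trans ?_)
    exact natDegree_map_le.trans hAB.natDegree_left
  · have h1 : X * B.map Complex.ofRealHom = (X * B).map Complex.ofRealHom := by simp
    rw [h1]
    exact natDegree_map_le.trans hAB.natDegree_right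
  · have h1 := congrArg (map Complex.ofRealHom) hpar
    have h2 := congrArg (map Complex.ofRealHom) hAB.parity_left
    simp only [map_comp, Polynomial.map_neg, map_X, Polynomial.map_mul, Polynomial.map_pow,
      Polynomial.map_one] at h1 h2
    simp only [add_comp, mul_comp, C_comp, h1, h2]
    ring
  · have h2 := congrArg (map Complex.ofRealHom) hAB.parity_right
    simpa only [map_comp, Polynomial.map_neg, map_X, Polynomial.map_mul, Polynomial.map_pow,
      Polynomial.map_one] using h2
  · intro x _
    rw [hR, ← Complex.ofRealHom_eq_coe x, eval_map_apply, Complex.ofRealHom_eq_coe,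
      Complex.norm_real, Real.norm_eq_abs, sq_abs, Complex.sq_norm, Complex.normSq_add_mul_I]
    have h1 := congrArg (eval x) e
    simp only [eval_sub, eval_add, eval_mul, eval_pow, eval_one, eval_X] at h1
    linarith
  · intro x
    rw [hR]
    simp

/-! ### Quantum signal processing -/

/-- The coordinates of `e^{iφZ} v` from those of `v` in the eigenbasis of `Z`. -/
noncomputable def phaseRot (φ : ℝ) (p : ℂ × ℂ) : ℂ × ℂ :=
  (Complex.exp (Complex.I * φ) * p.1, Complex.exp (-(Complex.I * φ)) * p.2)

/-- The change of coordinates between the bases `ψ, ψ^⊥` and `Π, Π^⊥`: the reflection with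
matrix `[[x, y], [y, -x]]`, where `x = ‖Πψ‖` and `y = √(1-x²)`. It is an involution, so that it
serves in both directions. -/
def basisChange (x y : ℝ) (p : ℂ × ℂ) : ℂ × ℂ :=
  (x * p.1 + y * p.2, y * p.1 - x * p.2)

/-- The coordinates after rotations about alternating axes, in the basis of the last axis. The
first rotation is by `φ₀`; the others are listed in reverse order of execution. -/
noncomputable def amplitudes (x y φ₀ : ℝ) (p : ℂ × ℂ) : List ℝ → ℂ × ℂ
  | [] => phaseRot φ₀ p
  | φ :: l => phaseRot φ (basisChange x y (amplitudes x y φ₀ p l))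

theorem exists_phase {p q : ℂ} (h : ‖p‖ = ‖q‖) :
    ∃ φ : ℝ, Complex.exp (-(Complex.I * φ)) * p = Complex.exp (Complex.I * φ) * q := by
  refine ⟨(p.arg - q.arg) / 2, ?_⟩
  rw [← Complex.norm_mul_exp_arg_mul_I p, ← Complex.norm_mul_exp_arg_mul_I q, h,
    mul_left_comm, mul_left_comm (Complex.exp _) (‖q‖ : ℂ), ← Complex.exp_add, ← Complex.exp_add,
    Complex.norm_mul_exp_arg_mul_I q, ← h, Complex.norm_mul_exp_arg_mul_I p]
  congr 2
  push_cast
  ring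

theorem exp_I_mul_exp_neg_I (φ : ℝ) :
    Complex.exp (Complex.I * φ) * Complex.exp (-(Complex.I * φ)) = 1 := by
  rw [← Complex.exp_add, add_neg_cancel, Complex.exp_zero]

theorem norm_exp_I (φ : ℝ) : ‖Complex.exp (Complex.I * φ)‖ = 1 := by
  rw [mul_comm, Complex.norm_exp_ofReal_mul_I]

theorem norm_exp_neg_I (φ : ℝ) : ‖Complex.exp (-(Complex.I * φ))‖ = 1 := by
  have := norm_exp_I (-φ)
  rwa [Complex.ofReal_neg, mul_neg] at this

theorem conj_exp_I (φ : ℝ) :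
    starRingEnd ℂ (Complex.exp (Complex.I * φ)) = Complex.exp (-(Complex.I * φ)) := by
  rw [← Complex.exp_conj]
  simp

theorem conj_exp_neg_I (φ : ℝ) :
    starRingEnd ℂ (Complex.exp (-(Complex.I * φ))) = Complex.exp (Complex.I * φ) := by
  rw [← Complex.exp_conj]
  simp

theorem norm_phaseRot (φ : ℝ) (p : ℂ × ℂ) :
    ‖(phaseRot φ p).1‖ ^ 2 + ‖(phaseRot φ p).2‖ ^ 2 = ‖p.1‖ ^ 2 + ‖p.2‖ ^ 2 := by
  simp [phaseRot, norm_exp_neg_I]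

theorem norm_basisChange {x y : ℝ} (h : x ^ 2 + y ^ 2 = 1) (p : ℂ × ℂ) :
    ‖(basisChange x y p).1‖ ^ 2 + ‖(basisChange x y p).2‖ ^ 2 = ‖p.1‖ ^ 2 + ‖p.2‖ ^ 2 := by
  simp only [Complex.sq_norm, Complex.normSq_apply, basisChange]
  simp
  linear_combination (p.1.re ^ 2 + p.1.im ^ 2 + p.2.re ^ 2 + p.2.im ^ 2) * h

theorem norm_amplitudes {x y : ℝ} (h : x ^ 2 + y ^ 2 = 1) (φ₀ : ℝ) (p : ℂ × ℂ) (l : List ℝ) :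
    ‖(amplitudes x y φ₀ p l).1‖ ^ 2 + ‖(amplitudes x y φ₀ p l).2‖ ^ 2 =
      ‖p.1‖ ^ 2 + ‖p.2‖ ^ 2 := by
  induction l with
  | nil => exact norm_phaseRot φ₀ p
  | cons φ l ih => rw [amplitudes, norm_phaseRot, norm_basisChange h, ih]

/-- The sequence of rotations has determinant `± 1`, so that the second row of its matrix is
determined by the first one. -/
theorem amplitudes_second (x y φ₀ : ℝ) (c : ℝ) (l : List ℝ) :
    amplitudes x y φ₀ (0, c) l =
      (-((-1) ^ l.length * starRingEnd ℂ (amplitudes x y φ₀ (c, 0) l).2),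
        (-1) ^ l.length * starRingEnd ℂ (amplitudes x y φ₀ (c, 0) l).1) := by
  induction l with
  | nil => simp [amplitudes, phaseRot, conj_exp_I]
  | cons φ l ih =>
    rw [amplitudes, ih]
    ext <;> simp [amplitudes, phaseRot, basisChange, conj_exp_I, conj_exp_neg_I] <;> ring

theorem amplitudes_smul (x y φ₀ : ℝ) (c : ℂ) (l : List ℝ) :
    amplitudes x y φ₀ (c, 0) l =
      (c * (amplitudes x y φ₀ (1, 0) l).1, c * (amplitudes x y φ₀ (1, 0) l).2) := by
  induction l with
  | nil => simp [amplitudes, phaseRot, mul_comm]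
  | cons φ l ih =>
    rw [amplitudes, ih]
    ext <;> simp [amplitudes, phaseRot, basisChange] <;> ring

/-- Rotations in the opposite direction conjugate the amplitudes, as the change of basis is
real. -/
theorem amplitudes_neg (x y φ₀ : ℝ) (p : ℂ × ℂ) (l : List ℝ) :
    amplitudes x y (-φ₀) (starRingEnd ℂ p.1, starRingEnd ℂ p.2) (l.map Neg.neg) =
      (starRingEnd ℂ (amplitudes x y φ₀ p l).1, starRingEnd ℂ (amplitudes x y φ₀ p l).2) := by
  induction l with
  | nil => simp [amplitudes, phaseRot, conj_exp_I, conj_exp_neg_I]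
  | cons φ l ih =>
    rw [List.map_cons, amplitudes, ih]
    ext <;> simp [amplitudes, phaseRot, basisChange, conj_exp_I, conj_exp_neg_I]

/-- A vanishing coefficient at `d + 2` lowers the degree by two: the parity kills the next one. -/
theorem natDegree_le_of_parity {R : Type*} [CommRing R] [IsDomain R] [CharZero R] {d : ℕ}
    {P : R[X]} (hd : P.natDegree ≤ d + 2) (hc : P.coeff (d + 2) = 0)
    (hp : P.comp (-X) = (-1) ^ d * P) : P.natDegree ≤ d := by
  have h1 : P.coeff (d + 1) = 0 := by
    have h2 := congrArg (fun S => S.coeff (d + 1)) hp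
    have e : ((-1) ^ d * P : R[X]) = C ((-1) ^ d) * P := by simp
    simp only [e, coeff_comp_neg_X, coeff_C_mul, pow_succ, mul_neg, mul_one, neg_mul] at h2
    have h3 := self_eq_neg.1 h2.symm
    exact (mul_eq_zero.1 h3).resolve_left (pow_ne_zero _ (neg_ne_zero.2 one_ne_zero))
  refine natDegree_le_iff_coeff_eq_zero.2 fun n hn => ?_
  rcases (by lia : n = d + 1 ∨ n = d + 2 ∨ d + 2 < n) with rfl | rfl | h
  · exact h1
  · exact hc
  · exact coeff_eq_zero_of_natDegree_lt (hd.trans_lt h)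

/-- Quantum signal processing: every Pell pair is the first row of an alternating sequence of
rotations. The leading coefficients of the pair have the same absolute value; the last phase is
chosen so that they cancel when the last rotation and change of basis are undone. -/
theorem exists_phases (d : ℕ) : ∀ P Q : ℂ[X], IsPellShape d P Q →
    (∀ x ∈ Set.Icc (-1 : ℝ) 1,
      ‖P.eval (x : ℂ)‖ ^ 2 + (1 - x ^ 2) * ‖Q.eval (x : ℂ)‖ ^ 2 = 1) →
    ∃ (φ₀ : ℝ) (l : List ℝ), l.length = d ∧ ∀ x ∈ Set.Icc (-1 : ℝ) 1, ∀ y : ℝ,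
      x ^ 2 + y ^ 2 = 1 →
        amplitudes x y φ₀ (1, 0) l = (P.eval (x : ℂ), y * Q.eval (x : ℂ)) := by
  induction d with
  | zero =>
    intro P Q hS h
    have hQ : Q = 0 := by
      by_contra h0
      have := hS.natDegree_right
      rw [natDegree_X_mul h0] at this
      lia
    have hP := eq_C_of_natDegree_le_zero hS.natDegree_left
    generalize P.coeff 0 = c at hP
    subst hQ hP
    have hc : ‖c‖ = 1 := (pow_eq_one_iff_of_nonneg (norm_nonneg c) two_ne_zero).1 <| by
      simpa using h 1 (by simp)
    refine ⟨c.arg, [], rfl, fun x _ y _ => ?_⟩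
    have := Complex.norm_mul_exp_arg_mul_I c
    rw [hc, Complex.ofReal_one, one_mul] at this
    simp [amplitudes, phaseRot, mul_comm Complex.I, this]
  | succ d ih =>
    intro P Q hS h
    have hQdeg : Q.natDegree ≤ d := by
      by_cases h0 : Q = 0
      · simp [h0]
      · have := hS.natDegree_right
        rw [natDegree_X_mul h0] at this
        lia
    have hlead : ‖P.coeff (d + 1)‖ = ‖Q.coeff d‖ := by
      have e := congrArg (fun S => S.coeff (d + 1 + (d + 1))) (pell_identity h)
      have e1 : (1 - X ^ 2) * (Q * Q.map (starRingEnd ℂ)) =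
          Q * Q.map (starRingEnd ℂ) - Q * Q.map (starRingEnd ℂ) * X ^ 2 := by ring
      have e2 : (Q * Q.map (starRingEnd ℂ)).natDegree ≤ d + d :=
        natDegree_mul_le_of_le hQdeg (natDegree_map_le.trans hQdeg)
      have e3 : (Q * Q.map (starRingEnd ℂ)).coeff (d + d) =
          Q.coeff d * starRingEnd ℂ (Q.coeff d) := by
        rw [coeff_mul_add_eq_of_natDegree_le hQdeg (natDegree_map_le.trans hQdeg), coeff_map]
      have e4 : (P * P.map (starRingEnd ℂ)).coeff (d + 1 + (d + 1)) =
          P.coeff (d + 1) * starRingEnd ℂ (P.coeff (d + 1)) := by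
        rw [coeff_mul_add_eq_of_natDegree_le hS.natDegree_left
          (natDegree_map_le.trans hS.natDegree_left), coeff_map]
      simp only [e1, coeff_add, coeff_sub, e4] at e
      rw [coeff_eq_zero_of_natDegree_lt (e2.trans_lt (by lia : d + d < d + 1 + (d + 1))),
        show d + 1 + (d + 1) = d + d + 2 by ring, coeff_mul_X_pow, e3,
        coeff_one, if_neg (by lia), Complex.mul_conj', Complex.mul_conj'] at e
      have e5 : ‖P.coeff (d + 1)‖ ^ 2 = ‖Q.coeff d‖ ^ 2 := by
        have : ((‖P.coeff (d + 1)‖ ^ 2 : ℝ) : ℂ) = ((‖Q.coeff d‖ ^ 2 : ℝ) : ℂ) := by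
          push_cast
          linear_combination e
        exact_mod_cast this
      exact (sq_eq_sq₀ (norm_nonneg _) (norm_nonneg _)).1 e5
    obtain ⟨φ, hφ⟩ := exists_phase hlead
    set w := Complex.exp (Complex.I * φ) with hw
    set w' := Complex.exp (-(Complex.I * φ)) with hw'
    have hww : w * w' = 1 := exp_I_mul_exp_neg_I φ
    have hpar : (X * (C w' * P) + (1 - X ^ 2) * (C w * Q)).comp (-X) =
        (-1) ^ d * (X * (C w' * P) + (1 - X ^ 2) * (C w * Q)) := by
      simp only [add_comp, sub_comp, mul_comp, pow_comp, one_comp, X_comp, C_comp,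
        hS.parity_left, hS.parity_right]
      ring
    have hpar' : (C w' * P - X * (C w * Q)).comp (-X) =
        -((-1) ^ d * (C w' * P - X * (C w * Q))) := by
      simp only [sub_comp, mul_comp, X_comp, C_comp, hS.parity_left, hS.parity_right]
      ring
    have hP1 : (C w' * P).natDegree ≤ d + 1 := (natDegree_C_mul_le _ _).trans hS.natDegree_left
    have hQ1 : (C w * Q).natDegree ≤ d := (natDegree_C_mul_le _ _).trans hQdeg
    have hX : ∀ {S : ℂ[X]} {n : ℕ}, S.natDegree ≤ n → (X * S).natDegree ≤ n + 1 :=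
      fun hS => (natDegree_mul_le_of_le natDegree_X_le hS).trans (add_comm _ _).le
    have eP : X * (C w' * P) + (1 - X ^ 2) * (C w * Q) =
        X * (C w' * P) + C w * Q - X * (X * (C w * Q)) := by ring
    have hdegP : (X * (C w' * P) + (1 - X ^ 2) * (C w * Q)).natDegree ≤ d + 2 := by
      rw [eP]
      exact (natDegree_sub_le_of_le (natDegree_add_le_of_degree_le (hX hP1)
        (hQ1.trans (by lia))) (hX (hX hQ1))).trans (max_self _).le
    have hcoeffP : (X * (C w' * P) + (1 - X ^ 2) * (C w * Q)).coeff (d + 2) = 0 := by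
      rw [eP, coeff_sub, coeff_add, coeff_X_mul, coeff_X_mul, coeff_X_mul,
        coeff_eq_zero_of_natDegree_lt (hQ1.trans_lt (by lia : d < d + 2)), coeff_C_mul,
        coeff_C_mul, hφ]
      ring
    have hdegQ : (X * (C w' * P - X * (C w * Q))).natDegree ≤ d + 2 :=
      hX ((natDegree_sub_le_of_le hP1 (hX hQ1)).trans (max_self _).le)
    have hcoeffQ : (X * (C w' * P - X * (C w * Q))).coeff (d + 2) = 0 := by
      rw [coeff_X_mul, coeff_sub, coeff_X_mul, coeff_C_mul, coeff_C_mul, hφ, sub_self]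
    have hparX : (X * (C w' * P - X * (C w * Q))).comp (-X) =
        (-1) ^ d * (X * (C w' * P - X * (C w * Q))) := by
      rw [mul_comp, X_comp, hpar']
      ring
    have hnorm : ∀ x ∈ Set.Icc (-1 : ℝ) 1,
        ‖(X * (C w' * P) + (1 - X ^ 2) * (C w * Q)).eval (x : ℂ)‖ ^ 2 +
          (1 - x ^ 2) * ‖(C w' * P - X * (C w * Q)).eval (x : ℂ)‖ ^ 2 = 1 := by
      intro x hx
      have hy0 : 0 ≤ 1 - x ^ 2 := by nlinarith [hx.1, hx.2]
      have hy : x ^ 2 + √(1 - x ^ 2) ^ 2 = 1 := by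
        rw [Real.sq_sqrt hy0]
        ring
      have hy' : ((√(1 - x ^ 2) : ℝ) : ℂ) ^ 2 = 1 - x ^ 2 := by
        rw [← Complex.ofReal_pow, Real.sq_sqrt hy0]
        push_cast
        ring
      have h1 := norm_basisChange hy (w' * P.eval (x : ℂ), √(1 - x ^ 2) * (w * Q.eval (x : ℂ)))
      have h2 : (basisChange x √(1 - x ^ 2)
          (w' * P.eval (x : ℂ), √(1 - x ^ 2) * (w * Q.eval (x : ℂ)))) =
          ((X * (C w' * P) + (1 - X ^ 2) * (C w * Q)).eval (x : ℂ),
            ((√(1 - x ^ 2) : ℝ) : ℂ) * (C w' * P - X * (C w * Q)).eval (x : ℂ)) := by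
        simp only [basisChange, eval_add, eval_sub, eval_mul, eval_pow, eval_one, eval_X, eval_C]
        ext
        · linear_combination w * Q.eval (x : ℂ) * hy'
        · ring
      rw [h2] at h1
      simp only [norm_mul, mul_pow, Complex.norm_real, Real.norm_eq_abs, sq_abs,
        Real.sq_sqrt hy0, hw, hw', norm_exp_I, norm_exp_neg_I, one_mul, h x hx] at h1
      exact h1
    obtain ⟨φ₀, l, hl, hamp⟩ := ih (X * (C w' * P) + (1 - X ^ 2) * (C w * Q))
      (C w' * P - X * (C w * Q)) ⟨natDegree_le_of_parity hdegP hcoeffP hpar,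
        natDegree_le_of_parity hdegQ hcoeffQ hparX, hpar, hpar'⟩ hnorm
    refine ⟨φ₀, φ :: l, by simp [hl], fun x hx y hxy => ?_⟩
    rw [amplitudes, hamp x hx y hxy]
    have hxy' : (x : ℂ) ^ 2 + (y : ℂ) ^ 2 = 1 := by exact_mod_cast hxy
    simp only [phaseRot, basisChange, eval_add, eval_sub, eval_mul, eval_pow, eval_one, eval_X,
      eval_C, ← hw, ← hw']
    ext
    · linear_combination (P.eval (x : ℂ)) * hww +
        w * (w' * P.eval (x : ℂ) - x * w * Q.eval (x : ℂ)) * hxy'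
    · linear_combination (y * Q.eval (x : ℂ)) * hww

/-! ### The Grover frame up to signs -/

/-- The other one of the two bases. -/
def Axis.other : Axis → Axis
  | .psi => .proj
  | .proj => .psi

section Frame

variable {H : Type*} [NormedAddCommGroup H] [InnerProductSpace ℂ H]

/-- The vector with given coordinates in one of the two bases. -/
def combine (e : Label → H) (s : Axis) (p : ℂ × ℂ) : H :=
  p.1 • e (s, false) + p.2 • e (s, true)

/-- What the analysis of the algorithms uses about the four states and the oracles: unit vectors
on which the rotations act by phases, and a change of basis by the reflection
`[[x, y], [y, -x]]`. -/
structure IsRotationFrame (O : Axis → ℝ → (H ≃ₗᵢ[ℂ] H)) (x y : ℝ) (e : Label → H) : Prop where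
  norm_eq : ∀ l, ‖e l‖ = 1
  rotate_false : ∀ s φ, O s φ (e (s, false)) = Complex.exp (Complex.I * φ) • e (s, false)
  rotate_true : ∀ s φ, O s φ (e (s, true)) = Complex.exp (-(Complex.I * φ)) • e (s, true)
  change_false : ∀ s, e (s, false) = (x : ℂ) • e (s.other, false) + (y : ℂ) • e (s.other, true)
  change_true : ∀ s, e (s, true) = (y : ℂ) • e (s.other, false) - (x : ℂ) • e (s.other, true)

theorem IsRotationFrame.rotate_combine {O : Axis → ℝ → (H ≃ₗᵢ[ℂ] H)} {x y : ℝ} {e : Label → H}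
    (h : IsRotationFrame O x y e) (s : Axis) (φ : ℝ) (p : ℂ × ℂ) :
    O s φ (combine e s p) = combine e s (phaseRot φ p) := by
  simp only [combine, phaseRot, map_add, map_smul, h.rotate_false, h.rotate_true, smul_smul]
  simp only [mul_comm]

theorem IsRotationFrame.combine_change {O : Axis → ℝ → (H ≃ₗᵢ[ℂ] H)} {x y : ℝ} {e : Label → H}
    (h : IsRotationFrame O x y e) (s : Axis) (p : ℂ × ℂ) :
    combine e s p = combine e s.other (basisChange x y p) := by
  rw [combine, h.change_false s, h.change_true s, combine, basisChange]
  module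

theorem exp_apply_of_eigen [CompleteSpace H] {T : H →L[ℂ] H} {μ : ℂ} {v : H} (h : T v = μ • v) :
    NormedSpace.exp T v = Complex.exp μ • v := by
  have hpow : ∀ n : ℕ, (T ^ n) v = μ ^ n • v := by
    intro n
    induction n with
    | zero => simp
    | succ n ih => rw [pow_succ, mul_apply_eq_comp, h, map_smul, ih, smul_smul, pow_succ']
  have h1 := (NormedSpace.exp_series_hasSum_exp' (𝕂 := ℂ) T).mapL
    (ContinuousLinearMap.apply ℂ H v)
  have h2 := (NormedSpace.exp_series_hasSum_exp' (𝕂 := ℂ) μ).smul_const v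
  rw [← Complex.exp_eq_exp_ℂ] at h2
  refine h1.unique ?_
  convert h2 using 2 with n
  simp [hpow, smul_smul]

/-- For `a = 1` the state `ψ^⊥` of a Grover frame is the opposite of what the reflection gives,
which is why a sign `σ` is needed. -/
theorem GroverFrame.exists_sign [CompleteSpace H] {Pr : H →L[ℂ] H} {ψ : H}
    (G : GroverFrame Pr ψ) (hPr : IsStarProjection Pr) (hψ : ‖ψ‖ = 1) :
    ‖Pr ψ‖ ≤ 1 ∧ ‖G.proj‖ = 1 ∧ ‖G.projPerp‖ = 1 ∧ inner ℂ G.proj G.projPerp = 0 ∧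
    ψ = ((‖Pr ψ‖ : ℝ) : ℂ) • G.proj + ((√(1 - ‖Pr ψ‖ ^ 2) : ℝ) : ℂ) • G.projPerp ∧
    ∃ σ : ℝ, (σ = 1 ∨ σ = -1) ∧ G.psiPerp = (σ : ℂ) •
      (((√(1 - ‖Pr ψ‖ ^ 2) : ℝ) : ℂ) • G.proj - ((‖Pr ψ‖ : ℝ) : ℂ) • G.projPerp) := by
  have hsym := (ContinuousLinearMap.isStarProjection_iff_isSymmetricProjection.1 hPr).isSymmetric
  have hid : Pr (Pr ψ) = Pr ψ := by
    rw [← mul_apply_eq_comp, hPr.isIdempotentElem.eq]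
  have hin : inner ℂ (Pr ψ) ψ = ((‖Pr ψ‖ ^ 2 : ℝ) : ℂ) := by
    have : inner ℂ (Pr (Pr ψ)) ψ = inner ℂ (Pr ψ) (Pr ψ) := hsym _ _
    rw [hid, inner_self_eq_norm_sq_to_K] at this
    simpa using this
  have horth : inner ℂ (Pr ψ) (ψ - Pr ψ) = 0 := by
    rw [inner_sub_right, hin, inner_self_eq_norm_sq_to_K]
    simp
  have hpyth : ‖Pr ψ‖ ^ 2 + ‖ψ - Pr ψ‖ ^ 2 = 1 := by
    have := norm_add_sq_eq_norm_sq_add_norm_sq_of_inner_eq_zero _ _ horth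
    rw [add_sub_cancel, hψ] at this
    linarith
  have hle : ‖Pr ψ‖ ≤ 1 := by
    nlinarith [norm_nonneg (Pr ψ), sq_nonneg ‖ψ - Pr ψ‖]
  refine ⟨hle, ?_⟩
  by_cases h0 : ‖Pr ψ‖ = 0
  · obtain ⟨h1, h2, h3, h4⟩ := G.of_zero h0
    refine ⟨h2, by rw [h1, hψ], by rw [h1, ← inner_conj_symm, h3, map_zero], by simp [h0, h1],
      1, Or.inl rfl, by simp [h0, h4]⟩
  by_cases h1 : ‖Pr ψ‖ = 1
  · obtain ⟨h2, h3, h4, h5⟩ := G.of_one h1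
    refine ⟨by rw [h2, hψ], h3, by rw [h2, h4], by simp [h1, h2],
      -1, Or.inr rfl, by simp [h1, h5]⟩
  obtain ⟨h2, h3, h4⟩ := G.generic h0 h1
  have hperp : ‖ψ - Pr ψ‖ = √(1 - ‖Pr ψ‖ ^ 2) := by
    rw [← hpyth, add_sub_cancel_left, Real.sqrt_sq (norm_nonneg _)]
  have hb : √(1 - ‖Pr ψ‖ ^ 2) ≠ 0 := by
    refine (Real.sqrt_pos.2 ?_).ne'
    have := lt_of_le_of_ne hle h1
    nlinarith [norm_nonneg (Pr ψ)]
  refine ⟨?_, ?_, ?_, ?_, 1, Or.inl rfl, by rw [h4, Complex.ofReal_one, one_smul]⟩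
  · rw [h2, norm_smul, Complex.norm_real, norm_inv, norm_norm, inv_mul_cancel₀ h0]
  · rw [h3, norm_smul, hperp, Complex.norm_real, norm_inv, Real.norm_of_nonneg (Real.sqrt_nonneg _),
      inv_mul_cancel₀ hb]
  · rw [h2, h3, inner_smul_left, inner_smul_right, horth, mul_zero, mul_zero]
  · rw [h2, h3, smul_smul, smul_smul, ← Complex.ofReal_mul, ← Complex.ofReal_mul,
      mul_inv_cancel₀ h0, mul_inv_cancel₀ hb, Complex.ofReal_one, one_smul, one_smul,
      add_sub_cancel]

theorem GroverFrame.norm_mem_Icc [CompleteSpace H] {Pr : H →L[ℂ] H} {ψ : H}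
    (G : GroverFrame Pr ψ) (hPr : IsStarProjection Pr) (hψ : ‖ψ‖ = 1) :
    ‖Pr ψ‖ ∈ Set.Icc (-1 : ℝ) 1 ∧ ‖Pr ψ‖ ^ 2 + √(1 - ‖Pr ψ‖ ^ 2) ^ 2 = 1 := by
  have hle := (G.exists_sign hPr hψ).1
  have h0 := norm_nonneg (Pr ψ)
  refine ⟨⟨by linarith, hle⟩, ?_⟩
  rw [Real.sq_sqrt (by nlinarith)]
  ring

theorem GroverFrame.Z_apply {Pr : H →L[ℂ] H} {ψ : H} (G : GroverFrame Pr ψ) (s : Axis) (v : H) :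
    G.Z s v = inner ℂ (G.ket (s, false)) v • G.ket (s, false) -
      inner ℂ (G.ket (s, true)) v • G.ket (s, true) := by
  simp [GroverFrame.Z]

theorem GroverFrame.exists_isRotationFrame [CompleteSpace H] {Pr : H →L[ℂ] H} {ψ : H}
    (G : GroverFrame Pr ψ) (hPr : IsStarProjection Pr) (hψ : ‖ψ‖ = 1)
    {O : Axis → ℝ → (H ≃ₗᵢ[ℂ] H)} (hO : G.IsOracle O) :
    ∃ e : Label → H, IsRotationFrame O ‖Pr ψ‖ √(1 - ‖Pr ψ‖ ^ 2) e ∧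
      ∀ l, ∃ σ : ℝ, (σ = 1 ∨ σ = -1) ∧ G.ket l = (σ : ℂ) • e l := by
  obtain ⟨-, hn0, hn1, horth, hdec, σ, hσ, hperp⟩ := G.exists_sign hPr hψ
  have hab := (G.norm_mem_Icc hPr hψ).2
  have hσ2 : (σ : ℂ) * σ = 1 := by rcases hσ with rfl | rfl <;> simp
  have hket : G.ket (Axis.psi, false) = ψ ∧ G.ket (Axis.psi, true) = G.psiPerp ∧
    G.ket (Axis.proj, false) = G.proj ∧ G.ket (Axis.proj, true) = G.projPerp :=
    ⟨rfl, rfl, rfl, rfl⟩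
  obtain ⟨k1, k2, k3, k4⟩ := hket
  have hmem1 : ψ ∈ G.subspace := Submodule.subset_span (by simp)
  have hmem2 : G.psiPerp ∈ G.subspace := Submodule.subset_span (by simp)
  set a := ‖Pr ψ‖
  set b := √(1 - a ^ 2)
  have habC : (a : ℂ) ^ 2 + (b : ℂ) ^ 2 = 1 := by exact_mod_cast hab
  set χ : H := (b : ℂ) • G.proj - (a : ℂ) • G.projPerp with hχ
  have horth' : inner ℂ G.projPerp G.proj = 0 := by rw [← inner_conj_symm, horth, map_zero]
  have hs0 : inner ℂ G.proj G.proj = (1 : ℂ) := by rw [inner_self_eq_norm_sq_to_K, hn0]; simp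
  have hs1 : inner ℂ G.projPerp G.projPerp = (1 : ℂ) := by
    rw [inner_self_eq_norm_sq_to_K, hn1]; simp
  have hψχ : inner ℂ ψ χ = 0 := by
    rw [hdec, hχ]
    simp only [inner_add_left, inner_sub_right, inner_smul_left, inner_smul_right, horth, horth',
      hs0, hs1, Complex.conj_ofReal]
    ring
  have hχψ : inner ℂ χ ψ = 0 := by rw [← inner_conj_symm, hψχ, map_zero]
  have hχχ : inner ℂ χ χ = (1 : ℂ) := by
    rw [hχ]
    simp only [inner_sub_left, inner_sub_right, inner_smul_left, inner_smul_right, horth, horth',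
      hs0, hs1, Complex.conj_ofReal]
    linear_combination habC
  have hψψ : inner ℂ ψ ψ = (1 : ℂ) := by rw [inner_self_eq_norm_sq_to_K, hψ]; simp
  have hχperp : χ = (σ : ℂ) • G.psiPerp := by rw [hperp, smul_smul, hσ2, one_smul]
  have hproj : G.proj = (a : ℂ) • ψ + (b : ℂ) • χ := by
    have h1 : G.proj = (a : ℂ) • ((a : ℂ) • G.proj + (b : ℂ) • G.projPerp) + (b : ℂ) • χ := by
      rw [hχ]
      linear_combination (norm := module) (-habC) • G.proj
    rwa [← hdec] at h1
  have hprojPerp : G.projPerp = (b : ℂ) • ψ - (a : ℂ) • χ := by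
    have h1 : G.projPerp =
        (b : ℂ) • ((a : ℂ) • G.proj + (b : ℂ) • G.projPerp) - (a : ℂ) • χ := by
      rw [hχ]
      linear_combination (norm := module) (-habC) • G.projPerp
    rwa [← hdec] at h1
  have hmemχ : χ ∈ G.subspace := hχperp ▸ G.subspace.smul_mem _ hmem2
  have hrot : ∀ (s : Axis) (φ : ℝ) (μ : ℂ) (v : H), v ∈ G.subspace → G.Z s v = μ • v →
      O s φ v = Complex.exp (Complex.I * φ * μ) • v := by
    intro s φ μ v hv hZ
    rw [hO s φ v hv]
    apply exp_apply_of_eigen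
    rw [smul_apply, hZ, smul_smul]
  have hmem3 : G.proj ∈ G.subspace := by
    rw [hproj]
    exact G.subspace.add_mem (G.subspace.smul_mem _ hmem1) (G.subspace.smul_mem _ hmemχ)
  have hmem4 : G.projPerp ∈ G.subspace := by
    rw [hprojPerp]
    exact G.subspace.sub_mem (G.subspace.smul_mem _ hmem1) (G.subspace.smul_mem _ hmemχ)
  let e : Label → H := fun l =>
    match l with
    | (Axis.psi, false) => ψ
    | (Axis.psi, true) => χ
    | (Axis.proj, false) => G.proj
    | (Axis.proj, true) => G.projPerp
  refine ⟨e, ⟨?_, ?_, ?_, ?_, ?_⟩, ?_⟩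
  · have hnχ : ‖χ‖ = 1 := by
      have : ‖χ‖ ^ 2 = 1 := by rw [← inner_self_eq_norm_sq (𝕜 := ℂ), hχχ, RCLike.one_re]
      exact (pow_eq_one_iff_of_nonneg (norm_nonneg χ) two_ne_zero).1 this
    rintro ⟨s, j⟩
    cases s <;> cases j <;> assumption
  · intro s φ
    cases s
    · have := hrot Axis.psi φ 1 ψ hmem1 (by
        rw [G.Z_apply, k1, k2, hperp, hψψ, inner_smul_left, hχψ]; simp)
      simpa using this
    · have := hrot Axis.proj φ 1 G.proj hmem3 (by rw [G.Z_apply, k3, k4, hs0, horth']; simp)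
      simpa using this
  · intro s φ
    cases s
    · have := hrot Axis.psi φ (-1) χ hmemχ (by
        rw [G.Z_apply, k1, k2, hperp, hψχ, inner_smul_left, hχχ, smul_smul, Complex.conj_ofReal,
          mul_one, hσ2]
        simp)
      simpa using this
    · have := hrot Axis.proj φ (-1) G.projPerp hmem4 (by
        rw [G.Z_apply, k3, k4, hs1, horth]; simp)
      simpa using this
  · intro s
    cases s
    · exact hdec
    · exact hproj
  · intro s
    cases s
    · exact hχ
    · exact hprojPerp
  · rintro ⟨s, j⟩
    cases s <;> cases j
    · exact ⟨1, Or.inl rfl, by simp [k1, e]⟩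
    · exact ⟨σ, hσ, by rw [k2, hperp]⟩
    · exact ⟨1, Or.inl rfl, by simp [k3, e]⟩
    · exact ⟨1, Or.inl rfl, by simp [k4, e]⟩

end Frame

/-! ### Circuits of alternating rotations -/

section Circuit

variable {H : Type*} [NormedAddCommGroup H] [InnerProductSpace ℂ H]

theorem runCode_append (O : Axis → ℝ → (H ≃ₗᵢ[ℂ] H)) {κ : OracleKind} {n : ℕ}
    (c c' : List (Instr κ n)) (v : (Fin n → Bool) → H) :
    runCode O (c ++ c') v = (runCode O c v).flatMap fun p =>
      (runCode O c' p.2).map fun p' => (p.1 ++ p'.1, p'.2) := by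
  induction c generalizing v with
  | nil => simp [runCode]
  | cons i c ih =>
    simp [runCode, ih, List.flatMap_assoc, List.flatMap_map, List.map_flatMap, Function.comp_def]

theorem runCode_append_of_eq {O : Axis → ℝ → (H ≃ₗᵢ[ℂ] H)} {κ : OracleKind} {n : ℕ}
    {c : List (Instr κ n)} {v w : (Fin n → Bool) → H} (h : runCode O c v = [([], w)])
    (c' : List (Instr κ n)) : runCode O (c ++ c') v = runCode O c' w := by
  simp [runCode_append, h]

/-- The axis of the last rotation of `rotations g s φ₀ l`. -/
def finalAxis (s : Axis) : List ℝ → Axis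
  | [] => s
  | _ :: l => (finalAxis s l).other

/-- Rotations about alternating axes, the first one about `s` by `φ₀`, and the others with phases
listed in reverse order of execution, as in `amplitudes`. -/
def rotations {κ : OracleKind} {n : ℕ} (g : Axis → ℝ → Instr κ n) (s : Axis) (φ₀ : ℝ) :
    List ℝ → List (Instr κ n)
  | [] => [g s φ₀]
  | φ :: l => rotations g s φ₀ l ++ [g (finalAxis s l).other φ]

theorem queries_rotations {κ : OracleKind} {n : ℕ} {g : Axis → ℝ → Instr κ n}
    (hg : ∀ s φ, (g s φ).queries = 1) (s : Axis) (φ₀ : ℝ) (l : List ℝ) :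
    ((rotations g s φ₀ l).map Instr.queries).sum = l.length + 1 := by
  induction l with
  | nil => simp [rotations, hg]
  | cons φ l ih => simp [rotations, ih, hg]

theorem IsRotationFrame.runCode_rotate {O : Axis → ℝ → (H ≃ₗᵢ[ℂ] H)} {x y : ℝ} {e : Label → H}
    (h : IsRotationFrame O x y e) {n : ℕ} (s : Axis) (φ₀ : ℝ) (p : ℂ × ℂ) (l : List ℝ) :
    runCode O (rotations (n := n) Instr.rotate s φ₀ l) (fun _ => combine e s p) =
      [([], fun _ => combine e (finalAxis s l) (amplitudes x y φ₀ p l))] := by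
  induction l with
  | nil => simp [rotations, runCode, Instr.step, h.rotate_combine, finalAxis, amplitudes]
  | cons φ l ih =>
    rw [rotations, runCode_append_of_eq ih]
    simp only [h.combine_change (finalAxis s l)]
    simp [runCode, Instr.step, h.rotate_combine, finalAxis, amplitudes]

/-! ### Sampling with plain oracles -/

/-- The coordinates of the start vector, one of the two basis vectors up to a sign. -/
def startCoords (σ : ℝ) (j : Bool) : ℂ × ℂ := if j then (0, σ) else (σ, 0)

theorem combine_startCoords (e : Label → H) (s : Axis) (σ : ℝ) (j : Bool) :
    combine e s (startCoords σ j) = (σ : ℂ) • e (s, j) := by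
  cases j <;> simp [combine, startCoords]

/-- The coordinate with index `j`. -/
def coord (j : Bool) (p : ℂ × ℂ) : ℂ := if j then p.2 else p.1

/-- Up to a sign, the diagonal entries of the sequence of rotations are `P(x)` and its
conjugate. -/
theorem coord_amplitudes {x y φ₀ : ℝ} {l : List ℝ} {a b : ℂ}
    (h : amplitudes x y φ₀ (1, 0) l = (a, b)) {σ : ℝ} (hσ : σ = 1 ∨ σ = -1) (j : Bool) :
    ‖coord j (amplitudes x y φ₀ (startCoords σ j) l)‖ ^ 2 = ‖a‖ ^ 2 ∧
      (coord j (amplitudes x y φ₀ (startCoords σ j) l)).re ^ 2 = a.re ^ 2 := by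
  have hσ' : amplitudes x y φ₀ (σ, 0) l = (σ * a, σ * b) := by rw [amplitudes_smul, h]
  cases j
  · simp only [coord, startCoords, Bool.false_eq_true, if_false, hσ']
    rcases hσ with rfl | rfl <;> simp
  · simp only [coord, startCoords, if_true, amplitudes_second, hσ']
    rcases neg_one_pow_eq_or ℂ l.length with h1 | h1 <;> rcases hσ with rfl | rfl <;> simp [h1]

theorem norm_startCoords {x y : ℝ} (hxy : x ^ 2 + y ^ 2 = 1) (φ₀ : ℝ) (l : List ℝ) {σ : ℝ}
    (hσ : σ = 1 ∨ σ = -1) (j : Bool) :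
    ‖(amplitudes x y φ₀ (startCoords σ j) l).1‖ ^ 2 +
      ‖(amplitudes x y φ₀ (startCoords σ j) l).2‖ ^ 2 = 1 := by
  rw [norm_amplitudes hxy]
  rcases hσ with rfl | rfl <;> cases j <;> simp [startCoords]

theorem exp_I_pi_div_two : Complex.exp (Complex.I * ((Real.pi / 2 : ℝ) : ℂ)) = Complex.I := by
  rw [mul_comm, Complex.ofReal_div, Complex.ofReal_ofNat, Complex.exp_pi_div_two_mul_I]

theorem exp_neg_I_pi_div_two :
    Complex.exp (-(Complex.I * ((Real.pi / 2 : ℝ) : ℂ))) = -Complex.I := by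
  rw [Complex.exp_neg, exp_I_pi_div_two, Complex.inv_I]

theorem IsRotationFrame.step_hadamardTest {O : Axis → ℝ → (H ≃ₗᵢ[ℂ] H)} {x y : ℝ}
    {e : Label → H} (h : IsRotationFrame O x y e) {n : ℕ} (s : Axis) (p : ℂ × ℂ) :
    (Instr.hadamardTest (n := n) s).step O (fun _ => combine e s p) =
      [([false], fun _ => p.1 • e (s, false)), ([true], fun _ => p.2 • e (s, true))] := by
  have h1 : (2⁻¹ : ℂ) • (combine e s p + (-Complex.I) • combine e s (phaseRot (Real.pi / 2) p)) =
      p.1 • e (s, false) := by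
    simp only [combine, phaseRot, exp_I_pi_div_two, exp_neg_I_pi_div_two]
    match_scalars
    · linear_combination (-p.1 / 2) * Complex.I_sq
    · linear_combination (p.2 / 2) * Complex.I_sq
  have h2 : (2⁻¹ : ℂ) • (combine e s p - (-Complex.I) • combine e s (phaseRot (Real.pi / 2) p)) =
      p.2 • e (s, true) := by
    simp only [combine, phaseRot, exp_I_pi_div_two, exp_neg_I_pi_div_two]
    match_scalars
    · linear_combination (p.1 / 2) * Complex.I_sq
    · linear_combination (-p.2 / 2) * Complex.I_sq
  simp only [Instr.step, h.rotate_combine, h1, h2]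

/-- The defining properties of `Algorithm.Samples` in terms of an explicit list of branches. As the
vectors `e` agree with the four states up to signs, it makes no difference which ones are left. -/
theorem samples_mk {Pr : H →L[ℂ] H} {ψ : H} {G : GroverFrame Pr ψ}
    {O : Axis → ℝ → (H ≃ₗᵢ[ℂ] H)} {e : Label → H}
    (hG : ∀ l, ∃ σ : ℝ, (σ = 1 ∨ σ = -1) ∧ G.ket l = (σ : ℂ) • e l)
    {κ : OracleKind} {n : ℕ} {code : List (Instr κ n)} {bit : List Bool → Bool}
    {label : List Bool → Label} {v : H} {p : ℝ} {L : List (List Bool × ((Fin n → Bool) → H))}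
    (hrun : runCode O code (fun i => if i = fun _ => false then v else 0) = L)
    (h1 : ((L.filter fun r => bit r.1 == true).map fun r => ∑ i, ‖r.2 i‖ ^ 2).sum = p)
    (h0 : ((L.filter fun r => bit r.1 == false).map fun r => ∑ i, ‖r.2 i‖ ^ 2).sum = 1 - p)
    (hL : ∀ r ∈ L, ∃ c : (Fin n → Bool) → ℂ, ∀ i, r.2 i = c i • e (label r.1)) :
    (Algorithm.mk n code bit label).Samples G O v p := by
  subst hrun
  refine ⟨h1, h0, fun r hr => ?_⟩
  obtain ⟨c, hc⟩ := hL r hr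
  obtain ⟨τ, hτ, hk⟩ := hG (label r.1)
  refine ⟨fun i => c i * τ, fun i => ?_⟩
  change r.2 i = (c i * τ) • G.ket (label r.1)
  rw [hc, hk, smul_smul, mul_assoc]
  rcases hτ with rfl | rfl <;> simp

/-- Alternating rotations from the basis `l.1`, followed by a measurement in the last basis; the
output is `1` if the index of the state is found unchanged. -/
def plainAlgorithm (φ₀ : ℝ) (φs : List ℝ) (l : Label) : Algorithm OracleKind.plain where
  qubits := 0
  code := rotations Instr.rotate l.1 φ₀ φs ++ [Instr.hadamardTest (finalAxis l.1 φs)]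
  bit r := r == [l.2]
  label r := (finalAxis l.1 φs, r == [true])

theorem queries_plainAlgorithm (φ₀ : ℝ) (φs : List ℝ) (l : Label) :
    (plainAlgorithm φ₀ φs l).queries = φs.length + 2 := by
  have := queries_rotations (n := 0) (g := Instr.rotate) (fun s φ => by simp [Instr.queries])
    l.1 φ₀ φs
  simp [plainAlgorithm, Algorithm.queries, this, Instr.queries]

theorem samples_plainAlgorithm {Pr : H →L[ℂ] H} {ψ : H} {G : GroverFrame Pr ψ}
    {O : Axis → ℝ → (H ≃ₗᵢ[ℂ] H)} {x y : ℝ} {e : Label → H} (h : IsRotationFrame O x y e)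
    (hxy : x ^ 2 + y ^ 2 = 1) (hG : ∀ l, ∃ σ : ℝ, (σ = 1 ∨ σ = -1) ∧ G.ket l = (σ : ℂ) • e l)
    {φ₀ : ℝ} {φs : List ℝ} {a b : ℂ} (hab : amplitudes x y φ₀ (1, 0) φs = (a, b)) (l : Label) :
    (plainAlgorithm φ₀ φs l).Samples G O (G.ket l) (‖a‖ ^ 2) := by
  obtain ⟨σ, hσ, hl⟩ := hG l
  rw [← combine_startCoords] at hl
  have h1 := (coord_amplitudes hab hσ l.2).1
  have h2 := norm_startCoords hxy φ₀ φs hσ l.2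
  have hstart : (fun i : Fin 0 → Bool => if i = fun _ => false then G.ket l else 0) =
      fun _ => combine e l.1 (startCoords σ l.2) := by
    funext i
    rw [if_pos (Subsingleton.elim _ _), hl]
  refine samples_mk hG (L := [
    ([false], fun _ => (amplitudes x y φ₀ (startCoords σ l.2) φs).1 • e (finalAxis l.1 φs, false)),
    ([true], fun _ => (amplitudes x y φ₀ (startCoords σ l.2) φs).2 • e (finalAxis l.1 φs, true))])
    ?_ ?_ ?_ ?_
  · rw [hstart, runCode_append_of_eq (h.runCode_rotate l.1 φ₀ _ φs)]
    simp [runCode, h.step_hadamardTest]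
  · obtain ⟨s, _ | _⟩ := l <;> simpa [norm_smul, h.norm_eq, coord] using h1
  · obtain ⟨s, _ | _⟩ := l <;> simp only [coord, Bool.false_eq_true, if_false, if_true] at h1 <;>
      simp [norm_smul, h.norm_eq] <;> linarith
  · intro r hr
    simp only [List.mem_cons, List.not_mem_nil, or_false] at hr
    rcases hr with rfl | rfl
    · exact ⟨fun _ => _, fun _ => rfl⟩
    · exact ⟨fun _ => _, fun _ => rfl⟩

/-- The algorithm without queries that outputs `1` and does nothing. -/
def trivialAlgorithm (l : Label) : Algorithm OracleKind.plain where
  qubits := 0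
  code := []
  bit _ := true
  label _ := l

theorem samples_trivialAlgorithm {Pr : H →L[ℂ] H} {ψ : H} {G : GroverFrame Pr ψ}
    {O : Axis → ℝ → (H ≃ₗᵢ[ℂ] H)} {e : Label → H} (he : ∀ l, ‖e l‖ = 1)
    (hG : ∀ l, ∃ σ : ℝ, (σ = 1 ∨ σ = -1) ∧ G.ket l = (σ : ℂ) • e l) (l : Label) :
    (trivialAlgorithm l).Samples G O (G.ket l) 1 := by
  obtain ⟨σ, hσ, hl⟩ := hG l
  refine samples_mk hG (L := [([], fun _ => (σ : ℂ) • e l)]) ?_ ?_ ?_ ?_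
  · have : (fun i : Fin 0 → Bool => if i = fun _ => false then G.ket l else 0) =
        fun _ => (σ : ℂ) • e l := by
      funext i
      rw [if_pos (Subsingleton.elim _ _), hl]
    rw [this, runCode]
  · rcases hσ with rfl | rfl <;> simp [he]
  · simp
  · intro r hr
    rw [List.mem_singleton] at hr
    subst hr
    exact ⟨fun _ => _, fun _ => rfl⟩

end Circuit

/-! ### Sampling with signed oracles -/

section Signed

variable {H : Type*} [NormedAddCommGroup H] [InnerProductSpace ℂ H]

/-- The vector `|0⟩ ⊗ v₀ + |1⟩ ⊗ v₁` of one workspace qubit and the system. -/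
def qubitState (v₀ v₁ : H) : (Fin 1 → Bool) → H := fun i => if i 0 then v₁ else v₀

theorem sum_qubit {M : Type*} [AddCommMonoid M] (f : (Fin 1 → Bool) → M) :
    ∑ i, f i = f (fun _ => false) + f (fun _ => true) := by
  rw [← (Equiv.funUnique (Fin 1) Bool).symm.sum_comp f, Fintype.sum_bool, add_comm]
  rfl

theorem qubit_ext {M : Type*} {f g : (Fin 1 → Bool) → M}
    (h0 : f (fun _ => false) = g (fun _ => false)) (h1 : f (fun _ => true) = g (fun _ => true)) :
    f = g := by
  funext i
  have hi : i = fun _ => i 0 := by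
    funext k
    rw [Subsingleton.elim k 0]
  rw [hi]
  cases i 0
  · exact h0
  · exact h1

/-- The one-qubit unitary `[[u, -w̄], [w, ū]]`. -/
noncomputable def qubitGate (u w : ℂ) (h : ‖u‖ ^ 2 + ‖w‖ ^ 2 = 1) :
    Matrix.unitaryGroup (Fin 1 → Bool) ℂ :=
  ⟨Matrix.of fun i j => if i 0 then (if j 0 then starRingEnd ℂ u else w)
    else (if j 0 then -starRingEnd ℂ w else u), by
    have h' : u * starRingEnd ℂ u + w * starRingEnd ℂ w = 1 := by
      rw [Complex.mul_conj', Complex.mul_conj']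
      exact_mod_cast h
    have hne : (fun _ : Fin 1 => false) ≠ fun _ => true := fun h => by
      simpa using congrFun h 0
    rw [Matrix.mem_unitaryGroup_iff]
    refine qubit_ext (qubit_ext ?_ ?_) (qubit_ext ?_ ?_) <;>
      simp only [Matrix.mul_apply, sum_qubit, Matrix.star_apply, Matrix.of_apply,
        Bool.false_eq_true, if_false, if_true, Matrix.one_apply, RCLike.star_def, map_neg,
        Complex.conj_conj, hne, hne.symm]
    · linear_combination h'
    · ring
    · ring
    · linear_combination h'⟩

theorem step_qubitGate (O : Axis → ℝ → (H ≃ₗᵢ[ℂ] H)) {κ : OracleKind} (u w : ℂ)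
    (h : ‖u‖ ^ 2 + ‖w‖ ^ 2 = 1) (v₀ v₁ : H) :
    (Instr.work (κ := κ) (qubitGate u w h)).step O (qubitState v₀ v₁) =
      [([], qubitState (u • v₀ - starRingEnd ℂ w • v₁) (w • v₀ + starRingEnd ℂ u • v₁))] := by
  rw [Instr.step]
  congr 2
  refine qubit_ext ?_ ?_ <;> simp [sum_qubit, qubitGate, qubitState, sub_eq_add_neg]

theorem step_look (O : Axis → ℝ → (H ≃ₗᵢ[ℂ] H)) {κ : OracleKind} (v₀ v₁ : H) :
    (Instr.look (κ := κ) (0 : Fin 1)).step O (qubitState v₀ v₁) =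
      [([false], qubitState v₀ 0), ([true], qubitState 0 v₁)] := by
  rw [Instr.step]
  congr 3
  · refine qubit_ext ?_ ?_ <;> simp [qubitState]
  · refine qubit_ext ?_ ?_ <;> simp [qubitState]

theorem step_rotateSigned (O : Axis → ℝ → (H ≃ₗᵢ[ℂ] H)) (s : Axis) (φ : ℝ) (v₀ v₁ : H) :
    (Instr.rotateSigned (0 : Fin 1) s φ).step O (qubitState v₀ v₁) =
      [([], qubitState (O s φ v₀) (O s (-φ) v₁))] := by
  rw [Instr.step]
  congr 2
  refine qubit_ext ?_ ?_ <;> simp [qubitState]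

theorem norm_qubitState {E : Type*} [NormedAddCommGroup E] (v₀ v₁ : E) :
    ∑ i, ‖qubitState v₀ v₁ i‖ ^ 2 = ‖v₀‖ ^ 2 + ‖v₁‖ ^ 2 := by
  simp [sum_qubit, qubitState]

theorem qubitState_start {E : Type*} [NormedAddCommGroup E] (v : E) :
    (fun i : Fin 1 → Bool => if i = fun _ => false then v else 0) = qubitState v 0 := by
  refine qubit_ext ?_ ?_
  · simp [qubitState]
  · rw [if_neg fun h => by simpa using congrFun h 0]
    simp [qubitState]

theorem IsRotationFrame.runCode_rotateSigned {O : Axis → ℝ → (H ≃ₗᵢ[ℂ] H)} {x y : ℝ}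
    {e : Label → H} (h : IsRotationFrame O x y e) (s : Axis) (c : ℂ) (φ₀ : ℝ) (p p' : ℂ × ℂ)
    (l : List ℝ) :
    runCode O (rotations (Instr.rotateSigned (0 : Fin 1)) s φ₀ l)
        (qubitState (c • combine e s p) (c • combine e s p')) =
      [([], qubitState (c • combine e (finalAxis s l) (amplitudes x y φ₀ p l))
        (c • combine e (finalAxis s l) (amplitudes x y (-φ₀) p' (l.map Neg.neg))))] := by
  induction l with
  | nil =>
    simp [rotations, runCode, step_rotateSigned, h.rotate_combine, finalAxis, amplitudes]
  | cons φ l ih =>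
    rw [rotations, runCode_append_of_eq ih]
    simp only [h.combine_change (finalAxis s l)]
    simp [runCode, step_rotateSigned, h.rotate_combine, finalAxis, amplitudes]

/-- `1/√2` -/
noncomputable def invSqrtTwo : ℂ := ((√2)⁻¹ : ℝ)

theorem invSqrtTwo_mul_self : invSqrtTwo * invSqrtTwo = 1 / 2 := by
  rw [invSqrtTwo, ← Complex.ofReal_mul, ← mul_inv, Real.mul_self_sqrt zero_le_two]
  norm_num

theorem conj_invSqrtTwo : starRingEnd ℂ invSqrtTwo = invSqrtTwo := Complex.conj_ofReal _

theorem norm_invSqrtTwo : ‖invSqrtTwo‖ ^ 2 = 1 / 2 := by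
  rw [invSqrtTwo, Complex.norm_real, Real.norm_eq_abs, sq_abs, inv_pow, Real.sq_sqrt zero_le_two]
  norm_num

/-- The rotation that takes `|0⟩` to `(|0⟩ + |1⟩)/√2`. -/
noncomputable def splitGate : Matrix.unitaryGroup (Fin 1 → Bool) ℂ :=
  qubitGate invSqrtTwo invSqrtTwo (by rw [norm_invSqrtTwo]; norm_num)

/-- The inverse of `splitGate`. -/
noncomputable def mergeGate : Matrix.unitaryGroup (Fin 1 → Bool) ℂ :=
  qubitGate invSqrtTwo (-invSqrtTwo) (by rw [norm_neg, norm_invSqrtTwo]; norm_num)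

theorem norm_one_sub_I_div_two : ‖(1 - Complex.I) / 2‖ ^ 2 = 1 / 2 := by
  rw [Complex.sq_norm, Complex.normSq_apply]
  norm_num

/-- The unitary that takes `(e^{iπ/4}|0⟩ + e^{-iπ/4}|1⟩)/√2` and
`(e^{-iπ/4}|0⟩ + e^{iπ/4}|1⟩)/√2` to multiples of `|0⟩` and `|1⟩`. -/
noncomputable def testGate : Matrix.unitaryGroup (Fin 1 → Bool) ℂ :=
  qubitGate ((1 - Complex.I) / 2) (-((1 - Complex.I) / 2))
    (by rw [norm_neg, norm_one_sub_I_div_two]; norm_num)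

theorem exp_I_pi_div_four :
    Complex.exp (Complex.I * ((Real.pi / 4 : ℝ) : ℂ)) = invSqrtTwo * (1 + Complex.I) := by
  have h2 : √2 / 2 = (√2)⁻¹ := by
    rw [div_eq_iff two_ne_zero, eq_inv_mul_iff_mul_eq₀ (by positivity)]
    exact Real.mul_self_sqrt zero_le_two
  rw [mul_comm, Complex.exp_mul_I, ← Complex.ofReal_cos, ← Complex.ofReal_sin, Real.cos_pi_div_four,
    Real.sin_pi_div_four, h2, invSqrtTwo]
  ring

theorem exp_neg_I_pi_div_four :
    Complex.exp (-(Complex.I * ((Real.pi / 4 : ℝ) : ℂ))) = invSqrtTwo * (1 - Complex.I) := by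
  rw [← conj_exp_I, exp_I_pi_div_four, map_mul, conj_invSqrtTwo]
  simp [sub_eq_add_neg]

theorem exp_I_neg_pi_div_four :
    Complex.exp (Complex.I * ((-(Real.pi / 4) : ℝ) : ℂ)) = invSqrtTwo * (1 - Complex.I) := by
  rw [Complex.ofReal_neg, mul_neg, exp_neg_I_pi_div_four]

theorem exp_neg_I_neg_pi_div_four :
    Complex.exp (-(Complex.I * ((-(Real.pi / 4) : ℝ) : ℂ))) = invSqrtTwo * (1 + Complex.I) := by
  rw [Complex.ofReal_neg, mul_neg, neg_neg, exp_I_pi_div_four]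

/-- A measurement of the system by one signed query. The workspace qubit may be in either basis
state; the outcome is its value plus the index of the system, modulo `2`. -/
noncomputable def signedTest (s : Axis) : List (Instr OracleKind.signed 1) :=
  [Instr.work splitGate, Instr.rotateSigned 0 s (Real.pi / 4), Instr.work testGate, Instr.look 0]

theorem conj_one_sub_I_div_two :
    starRingEnd ℂ ((1 - Complex.I) / 2) = (1 + Complex.I) / 2 := by
  simp [map_ofNat]

theorem signedTest_add (e : Label → H) (s : Axis) (p : ℂ × ℂ) :
    ((1 - Complex.I) / 2) • invSqrtTwo • combine e s (phaseRot (Real.pi / 4) p) +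
      ((1 + Complex.I) / 2) • invSqrtTwo • combine e s (phaseRot (-(Real.pi / 4)) p) =
    p.1 • e (s, false) := by
  simp only [combine, phaseRot, exp_I_pi_div_four, exp_neg_I_pi_div_four, exp_I_neg_pi_div_four,
    exp_neg_I_neg_pi_div_four]
  match_scalars
  · linear_combination p.1 * (1 - Complex.I ^ 2) * invSqrtTwo_mul_self - p.1 / 2 * Complex.I_sq
  · linear_combination invSqrtTwo ^ 2 * p.2 * Complex.I_sq

theorem signedTest_sub (e : Label → H) (s : Axis) (p : ℂ × ℂ) :
    -(((1 - Complex.I) / 2) • invSqrtTwo • combine e s (phaseRot (Real.pi / 4) p)) +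
      ((1 + Complex.I) / 2) • invSqrtTwo • combine e s (phaseRot (-(Real.pi / 4)) p) =
    (Complex.I * p.2) • e (s, true) := by
  simp only [combine, phaseRot, exp_I_pi_div_four, exp_neg_I_pi_div_four, exp_I_neg_pi_div_four,
    exp_neg_I_neg_pi_div_four]
  match_scalars
  · ring
  · linear_combination 2 * Complex.I * p.2 * invSqrtTwo_mul_self

theorem IsRotationFrame.runCode_signedTest_zero {O : Axis → ℝ → (H ≃ₗᵢ[ℂ] H)} {x y : ℝ}
    {e : Label → H} (h : IsRotationFrame O x y e) (s : Axis) (p : ℂ × ℂ) :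
    runCode O (signedTest s) (qubitState (combine e s p) 0) =
      [([false], qubitState (p.1 • e (s, false)) 0),
        ([true], qubitState 0 ((Complex.I * p.2) • e (s, true)))] := by
  simp only [signedTest, runCode, splitGate, testGate, step_qubitGate, step_rotateSigned,
    step_look, List.flatMap_cons, List.flatMap_nil, List.map_cons, List.map_nil, List.append_nil,
    List.nil_append, List.cons_append, smul_zero, sub_zero, add_zero, map_smul, map_neg, neg_smul,
    sub_neg_eq_add, h.rotate_combine, conj_one_sub_I_div_two, signedTest_add, signedTest_sub]

theorem IsRotationFrame.runCode_signedTest_one {O : Axis → ℝ → (H ≃ₗᵢ[ℂ] H)} {x y : ℝ}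
    {e : Label → H} (h : IsRotationFrame O x y e) (s : Axis) (p : ℂ × ℂ) :
    runCode O (signedTest s) (qubitState 0 (combine e s p)) =
      [([false], qubitState ((Complex.I * p.2) • e (s, true)) 0),
        ([true], qubitState 0 (p.1 • e (s, false)))] := by
  simp only [signedTest, runCode, splitGate, testGate, step_qubitGate, step_rotateSigned,
    step_look, List.flatMap_cons, List.flatMap_nil, List.map_cons, List.map_nil, List.append_nil,
    List.nil_append, List.cons_append, smul_zero, zero_sub, zero_add, map_smul, map_neg, neg_smul,
    smul_neg, neg_neg, sub_neg_eq_add, h.rotate_combine, conj_one_sub_I_div_two, conj_invSqrtTwo,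
    signedTest_add, signedTest_sub]

/-- Alternating rotations and their inverses in superposition, a measurement of the workspace
qubit, which selects the real or the imaginary part of the amplitudes, and a measurement of the
system. The output is `1` if the real part is selected and the index of the state is found
unchanged. -/
noncomputable def signedAlgorithm (φ₀ : ℝ) (φs : List ℝ) (l : Label) :
    Algorithm OracleKind.signed where
  qubits := 1
  code := Instr.work splitGate :: (rotations (Instr.rotateSigned 0) l.1 φ₀ φs ++
    (Instr.work mergeGate :: Instr.look 0 :: signedTest (finalAxis l.1 φs)))
  bit r := r == [false, l.2]
  label r := (finalAxis l.1 φs, r == [false, true] || r == [true, false])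

theorem queries_signedAlgorithm (φ₀ : ℝ) (φs : List ℝ) (l : Label) :
    (signedAlgorithm φ₀ φs l).queries = φs.length + 2 := by
  have := queries_rotations (g := Instr.rotateSigned (0 : Fin 1))
    (fun s φ => by simp [Instr.queries]) l.1 φ₀ φs
  simp [signedAlgorithm, Algorithm.queries, this, Instr.queries, signedTest]

/-- The four branches. The start coordinates `p` are real, so that the branch of the workspace qubit
with opposite rotations has the conjugates of the amplitudes `q`. -/
theorem IsRotationFrame.runCode_signedAlgorithm {O : Axis → ℝ → (H ≃ₗᵢ[ℂ] H)} {x y : ℝ}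
    {e : Label → H} (h : IsRotationFrame O x y e) (φ₀ : ℝ) (φs : List ℝ) (l : Label) {p q : ℂ × ℂ}
    (hp : (starRingEnd ℂ p.1, starRingEnd ℂ p.2) = p) (hq : amplitudes x y φ₀ p φs = q) :
    runCode O (signedAlgorithm φ₀ φs l).code (qubitState (combine e l.1 p) 0) =
      [([false, false], qubitState ((q.1.re : ℂ) • e (finalAxis l.1 φs, false)) 0),
        ([false, true],
          qubitState 0 ((Complex.I * (q.2.re : ℂ)) • e (finalAxis l.1 φs, true))),
        ([true, false], qubitState
          ((Complex.I * (-(Complex.I * (q.2.im : ℂ)))) • e (finalAxis l.1 φs, true)) 0),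
        ([true, true],
          qubitState 0 ((-(Complex.I * (q.1.im : ℂ))) • e (finalAxis l.1 φs, false)))] := by
  have hneg := amplitudes_neg x y φ₀ p φs
  rw [hp, hq] at hneg
  have h1 := h.runCode_rotateSigned l.1 invSqrtTwo φ₀ p p φs
  rw [hneg, hq] at h1
  have hc := invSqrtTwo_mul_self
  have hre : invSqrtTwo • invSqrtTwo • combine e (finalAxis l.1 φs) q -
      starRingEnd ℂ (-invSqrtTwo) • invSqrtTwo • combine e (finalAxis l.1 φs)
        (starRingEnd ℂ q.1, starRingEnd ℂ q.2) =
      combine e (finalAxis l.1 φs) ((q.1.re : ℂ), (q.2.re : ℂ)) := by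
    simp only [combine, map_neg, conj_invSqrtTwo, Complex.re_eq_add_conj]
    match_scalars
    · linear_combination (q.1 + starRingEnd ℂ q.1) * hc
    · linear_combination (q.2 + starRingEnd ℂ q.2) * hc
  have him : (-invSqrtTwo) • invSqrtTwo • combine e (finalAxis l.1 φs) q +
      starRingEnd ℂ invSqrtTwo • invSqrtTwo • combine e (finalAxis l.1 φs)
        (starRingEnd ℂ q.1, starRingEnd ℂ q.2) =
      combine e (finalAxis l.1 φs)
        (-(Complex.I * (q.1.im : ℂ)), -(Complex.I * (q.2.im : ℂ))) := by
    have hz : ∀ z : ℂ, z - starRingEnd ℂ z = 2 * (Complex.I * z.im) := fun z => by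
      rw [Complex.sub_conj]
      push_cast
      ring
    simp only [combine, conj_invSqrtTwo]
    match_scalars
    · linear_combination (starRingEnd ℂ q.1 - q.1) * hc - (1 / 2) * hz q.1
    · linear_combination (starRingEnd ℂ q.2 - q.2) * hc - (1 / 2) * hz q.2
  simp only [signedAlgorithm, runCode, splitGate, step_qubitGate, List.flatMap_cons,
    List.flatMap_nil, List.append_nil, smul_zero, sub_zero, add_zero]
  rw [runCode_append_of_eq h1]
  simp only [runCode, mergeGate, step_qubitGate, hre, him, step_look, List.flatMap_cons,
    List.flatMap_nil, List.append_nil, h.runCode_signedTest_zero, h.runCode_signedTest_one,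
    List.map_cons, List.map_nil, List.nil_append, List.cons_append]

theorem samples_signedAlgorithm {Pr : H →L[ℂ] H} {ψ : H} {G : GroverFrame Pr ψ}
    {O : Axis → ℝ → (H ≃ₗᵢ[ℂ] H)} {x y : ℝ} {e : Label → H} (h : IsRotationFrame O x y e)
    (hxy : x ^ 2 + y ^ 2 = 1) (hG : ∀ l, ∃ σ : ℝ, (σ = 1 ∨ σ = -1) ∧ G.ket l = (σ : ℂ) • e l)
    {φ₀ : ℝ} {φs : List ℝ} {a b : ℂ} (hab : amplitudes x y φ₀ (1, 0) φs = (a, b)) (l : Label) :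
    (signedAlgorithm φ₀ φs l).Samples G O (G.ket l) (a.re ^ 2) := by
  obtain ⟨σ, hσ, hl⟩ := hG l
  rw [← combine_startCoords] at hl
  have h1 := (coord_amplitudes hab hσ l.2).2
  have h2 := norm_startCoords hxy φ₀ φs hσ l.2
  have hp : (starRingEnd ℂ (startCoords σ l.2).1, starRingEnd ℂ (startCoords σ l.2).2) =
      startCoords σ l.2 := by
    cases l.2 <;> simp [startCoords]
  have hrun := h.runCode_signedAlgorithm φ₀ φs l hp rfl
  rw [Complex.sq_norm, Complex.sq_norm, Complex.normSq_apply, Complex.normSq_apply] at h2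
  generalize amplitudes x y φ₀ (startCoords σ l.2) φs = q at h1 h2 hrun
  rw [← hl, ← qubitState_start] at hrun
  refine samples_mk hG hrun ?_ ?_ ?_
  · obtain ⟨s, _ | _⟩ := l <;>
      simpa [norm_qubitState, norm_smul, h.norm_eq, coord] using h1
  · obtain ⟨s, _ | _⟩ := l <;> simp only [coord, Bool.false_eq_true, if_false, if_true] at h1 <;>
      simp [norm_qubitState, norm_smul, h.norm_eq] <;> linarith
  · have hL₀ : ∀ (c : ℂ) (v : H), ∃ c' : (Fin 1 → Bool) → ℂ,
        ∀ i, qubitState (c • v) 0 i = c' i • v := fun c v =>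
      ⟨fun i => if i 0 then 0 else c, fun i => by simp only [qubitState]; split_ifs <;> simp⟩
    have hL₁ : ∀ (c : ℂ) (v : H), ∃ c' : (Fin 1 → Bool) → ℂ,
        ∀ i, qubitState 0 (c • v) i = c' i • v := fun c v =>
      ⟨fun i => if i 0 then c else 0, fun i => by simp only [qubitState]; split_ifs <;> simp⟩
    intro r hr
    simp only [List.mem_cons, List.not_mem_nil, or_false] at hr
    rcases hr with rfl | rfl | rfl | rfl
    · exact hL₀ _ (e (finalAxis l.1 φs, false))
    · exact hL₁ _ (e (finalAxis l.1 φs, true))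
    · exact hL₀ _ (e (finalAxis l.1 φs, true))
    · exact hL₁ _ (e (finalAxis l.1 φs, false))

/-- A coin toss without queries, with amplitudes `c` and `√(1-c²)`. -/
noncomputable def coinAlgorithm (c : ℝ) (hc : c ^ 2 ≤ 1) (l : Label) :
    Algorithm OracleKind.signed where
  qubits := 1
  code := [Instr.work (qubitGate c √(1 - c ^ 2) (by
    simp [Real.sq_sqrt (sub_nonneg.2 hc)])), Instr.look 0]
  bit r := r == [false]
  label _ := l

theorem samples_coinAlgorithm {Pr : H →L[ℂ] H} {ψ : H} {G : GroverFrame Pr ψ}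
    {O : Axis → ℝ → (H ≃ₗᵢ[ℂ] H)} {e : Label → H} (he : ∀ l, ‖e l‖ = 1)
    (hG : ∀ l, ∃ σ : ℝ, (σ = 1 ∨ σ = -1) ∧ G.ket l = (σ : ℂ) • e l) (c : ℝ) (hc : c ^ 2 ≤ 1)
    (l : Label) : (coinAlgorithm c hc l).Samples G O (G.ket l) (c ^ 2) := by
  obtain ⟨σ, hσ, hl⟩ := hG l
  have hnorm : ‖G.ket l‖ = 1 := by rcases hσ with rfl | rfl <;> simp [hl, he]
  refine samples_mk hG (L := [([false], qubitState ((c : ℂ) • G.ket l) 0),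
    ([true], qubitState 0 (((√(1 - c ^ 2) : ℝ) : ℂ) • G.ket l))]) ?_ ?_ ?_ ?_
  · rw [qubitState_start]
    simp [runCode, step_qubitGate, step_look]
  · simp [norm_qubitState, norm_smul, hnorm]
  · simp [norm_qubitState, norm_smul, hnorm, Real.sq_sqrt (sub_nonneg.2 hc)]
  · intro r hr
    rw [hl] at hr
    simp only [List.mem_cons, List.not_mem_nil, or_false] at hr
    rcases hr with rfl | rfl
    · refine ⟨fun i => if i 0 then 0 else c * σ, fun i => ?_⟩
      simp only [qubitState, smul_smul]
      split_ifs <;> simp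
    · refine ⟨fun i => if i 0 then (√(1 - c ^ 2) : ℝ) * σ else 0, fun i => ?_⟩
      simp only [qubitState, smul_smul]
      split_ifs <;> simp

end Signed

end PolySampling

open PolySampling
theorem theorem1 :
    ∃ C : ℕ,
      (∀ P : ℂ[X], IsPellian P →
        ∃ alg : Label → Algorithm OracleKind.plain,
          (∀ l : Label, (alg l).queries ≤ C * P.natDegree) ∧
          ∀ (H : Type*) [NormedAddCommGroup H] [InnerProductSpace ℂ H] [CompleteSpace H]
            (Pr : H →L[ℂ] H) (ψ : H) (G : GroverFrame Pr ψ) (O : Axis → ℝ → (H ≃ₗᵢ[ℂ] H)),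
            IsStarProjection Pr → ‖ψ‖ = 1 → G.IsOracle O →
            ∀ l : Label, (alg l).Samples G O (G.ket l) (‖P.eval ((‖Pr ψ‖ : ℝ) : ℂ)‖ ^ 2)) ∧
      (∀ P : ℝ[X], IsSemiPellian P →
        ∃ alg : Label → Algorithm OracleKind.signed,
          (∀ l : Label, (alg l).queries ≤ C * P.natDegree) ∧
          ∀ (H : Type*) [NormedAddCommGroup H] [InnerProductSpace ℂ H] [CompleteSpace H]
            (Pr : H →L[ℂ] H) (ψ : H) (G : GroverFrame Pr ψ) (O : Axis → ℝ → (H ≃ₗᵢ[ℂ] H)),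
            IsStarProjection Pr → ‖ψ‖ = 1 → G.IsOracle O →
            ∀ l : Label, (alg l).Samples G O (G.ket l) (|P.eval ‖Pr ψ‖| ^ 2)) := by
  -- For `d ≥ 1` there are `d + 1` rotations and one measurement, and `d + 2 ≤ 3 d`.
  refine ⟨3, fun P hP => ?_, fun P hP => ?_⟩
  · obtain ⟨Q, hPQ⟩ := hP
    rcases Nat.eq_zero_or_pos P.natDegree with h0 | h0
    · refine ⟨trivialAlgorithm, fun l => by simp [trivialAlgorithm, Algorithm.queries], ?_⟩
      intro H _ _ _ Pr ψ G O hPr hψ hO l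
      obtain ⟨e, he, hG⟩ := G.exists_isRotationFrame hPr hψ hO
      have h1 : ‖P.eval ((‖Pr ψ‖ : ℝ) : ℂ)‖ ^ 2 = 1 := by
        have := hPQ.2 1 (by simp)
        rw [eq_C_of_natDegree_eq_zero h0] at this ⊢
        simpa using this
      rw [h1]
      exact samples_trivialAlgorithm he.norm_eq hG l
    · obtain ⟨φ₀, φs, hlen, hamp⟩ := exists_phases _ P Q hPQ.isPellShape hPQ.2
      refine ⟨plainAlgorithm φ₀ φs, fun l => ?_, ?_⟩
      · rw [queries_plainAlgorithm, hlen]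
        lia
      intro H _ _ _ Pr ψ G O hPr hψ hO l
      obtain ⟨e, he, hG⟩ := G.exists_isRotationFrame hPr hψ hO
      obtain ⟨ha, hxy⟩ := G.norm_mem_Icc hPr hψ
      exact samples_plainAlgorithm he hxy hG (hamp _ ha _ hxy) l
  · obtain ⟨R, Q, hS, hRQ, hre⟩ := hP.exists_pell
    rcases Nat.eq_zero_or_pos P.natDegree with h0 | h0
    · have hc : P.coeff 0 ^ 2 ≤ 1 := by
        have h1 := hRQ 1 (by simp)
        have h2 := hre 1
        rw [eq_C_of_natDegree_eq_zero h0, eval_C] at h2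
        rw [← h2, ← sq_abs]
        have h3 := Complex.abs_re_le_norm (R.eval ((1 : ℝ) : ℂ))
        have h4 := abs_nonneg (R.eval ((1 : ℝ) : ℂ)).re
        nlinarith
      refine ⟨coinAlgorithm (P.coeff 0) hc, fun l => by
        simp [coinAlgorithm, Algorithm.queries, Instr.queries], ?_⟩
      intro H _ _ _ Pr ψ G O hPr hψ hO l
      obtain ⟨e, he, hG⟩ := G.exists_isRotationFrame hPr hψ hO
      have h1 : |P.eval ‖Pr ψ‖| ^ 2 = P.coeff 0 ^ 2 := by
        conv_lhs => rw [eq_C_of_natDegree_eq_zero h0]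
        rw [eval_C, sq_abs]
      rw [h1]
      exact samples_coinAlgorithm he.norm_eq hG _ hc l
    · obtain ⟨φ₀, φs, hlen, hamp⟩ := exists_phases _ R Q hS hRQ
      refine ⟨signedAlgorithm φ₀ φs, fun l => ?_, ?_⟩
      · rw [queries_signedAlgorithm, hlen]
        lia
      intro H _ _ _ Pr ψ G O hPr hψ hO l
      obtain ⟨e, he, hG⟩ := G.exists_isRotationFrame hPr hψ hO
      obtain ⟨ha, hxy⟩ := G.norm_mem_Icc hPr hψ
      rw [sq_abs, ← hre]
      exact samples_signedAlgorithm he hxy hG (hamp _ ha _ hxy) l
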